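/- **Network.** For $M\ge 0$ and $\varepsilon\in(0,1]$ consider the directed graph with the seven nodes $s_1,\ v,\ x,\ s_4,\ s_5,\ y,\ z$ and the seven edges $$e_1=(s_4,y),\quad e_2=(y,x),\quad e_3=(x,z),\quad e_4=(s_5,y),\quad e_5=(v,s_5),\quad e_6=(y,v),\quad e_7=(s_1,v),$$ with free flow travel times $\tau_{e_1}=\tau_{e_2}=\tau_{e_7}=1$, $\tau_{e_3}=\tau_{e_4}=\varepsilon$, $\tau_{e_5}=2-\varepsilon$, $\tau_{e_6}=4$ and service rates $\nu_{e_1}=\nu_{e_2}=\nu_{e_3}=1$, $\nu_{e_4}=\nu_{e_5}=2$, $\nu_{e_6}=\infty$, $\nu_{e_7}=6$. There are five commodities $i\in I=\{1,\dots,5\}$ with (source, destination) pairs $(s_1,v),\ (v,x),\ (x,z),\ (s_4,z),\ (s_5,y)$, network inflow rates $$r_1=6\cdot 1_{[0,1]},\quad r_2=2\cdot 1_{[2,3]},\quad r_3=1_{[7,10+M]},\quad r_4=1_{[4,5]},\quad r_5=2\cdot 1_{[9,13+M]},$$ and value-of-time parameters $\gamma_i=1$. Let $H'=[0,t_f']\subseteq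 H=[0,t_f]$ be horizons with $t_f'\ge 13+M$ and $t_f\ge t_f'+24+3M$. Let $L_+(H)$ be the set of nonnegative Lebesgue integrable functions on $H$, let $\mathcal W_i$ be the set of all finite walks (repetitions allowed) from the source to the destination of commodity $i$, and let $\mathcal W=\bigcup_i \mathcal W_i\times\{i\}$. **Travel times.** For an edge flow $g=(g_e)_e\in L_+(H)^E$ supported on $H'$, the traversal times $D_e(g,\cdot)$ are on $H'$ those of the Vickrey queuing model: with $T_e(g,t)=t+D_e(g,t)$ they are the unique solution of $$D_e(g,t)=\tau_e+\frac{q_e(g,t)}{\nu_e},\qquad q_e(g,t)=\int_0^t g_e\,d\sigma-\int_{T_e(g,\cdot)^{-1}([0,t+\tau_e])}g_e\,d\sigma ,$$ such that $q_e\ge 0$ and such that the outflow rate (the density of $t\mapsto\int_{T_e(g,\cdot)^{-1}([0,t])}g_e\,d\sigma$) exists and is at most $\nu_e$ almost everywhere. They are continued to $H$ in any nonnegative, absolutely continuous way for which $T_e(g,\cdot)$ is nondecreasing and all arrival times along walks stay in $H$. For a walk $w$ let $A_{w,1}(g,\cdot)=\mathrm{id}$ and $A_{w,j+1}(g,\cdot)=T_{w[j]}(g,\cdot)\circ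 A_{w,j}(g,\cdot)$. **Flows.** A walk flow $h=(h_w)_{w\in\mathcal W}\in L_+(H)^{\mathcal W}$ with $\sum_{w\in\mathcal W_i}h_w=r_i$ for all $i$ *induces* an edge flow $g\in L_+(H)^E$ supported on $H'$ if $$\int_0^t g_e\,d\sigma=\sum_{w\in\mathcal W}\ \sum_{j:\,w[j]=e}\ \int_{A_{w,j}(g,\cdot)^{-1}([0,t])}h_w\,d\sigma\qquad\text{for all edges } e \text{ and all } t\in H .$$ An edge flow is *system optimal* if it minimizes the total travel time $\sum_e\int_H D_e(g,t)\,g_e(t)\,dt$ among all edge flows induced by some walk flow. An edge flow $g$ is *implementable* (by anonymous dynamic tolls) if there are tolls $p:H\to\mathbb R_{\ge0}^E$ with $\sum_e\int_H p_e g_e\,d\sigma<\infty$ and a walk flow $h$ inducing $g$ such that for all $i$, all $w\in\mathcal W_i$ and almost all $t\in H$: if $h_w(t)>0$, then $w$ minimizes $$\gamma_i\sum_{j\le|w'|}D_{w'[j]}(g,A_{w',j}(g,t))+\sum_{j\le |w'|}p_{w'[j]}(A_{w',j}(g,t))$$ over all $w'\in\mathcal W_i$. **Theorem.** There is $M_0\ge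 0$ such that for all $M\ge M_0$ and all $\varepsilon\in(0,1]$ (and all horizons as above), no system optimal edge flow of this network is implementable. -/

import Mathlib

open Set MeasureTheory
open scoped ENNReal

/-- The data of a multi-source, multi-destination network with Vickrey queues: a finite directed
graph with nodes `V` and edges `E`, free flow travel times and (possibly infinite) service rates,
commodities `I` with sources, destinations, network inflow rates and values of time, the planning
horizon `H' = [0, tf']` and the larger technical horizon `H = [0, tf]`. -/
structure VickreyNetwork (V E I : Type) where
  tail : E → V
  head : E → V
  τ : E → ℝ
  ν : E → ℝ≥0∞
  source : I → V
  dest : I → V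
  inflow : I → ℝ → ℝ
  vot : I → ℝ
  tf' : ℝ
  tf : ℝ

namespace VickreyNetwork

variable {V E I : Type} (N : VickreyNetwork V E I)

/-- The full time horizon `H = [0, tf]`. -/
def H : Set ℝ := Icc 0 N.tf

/-- The planning horizon `H' = [0, tf']`. -/
def H' : Set ℝ := Icc 0 N.tf'

/-- `N.IsWalk v w v'`: the list of edges `w` is a walk from `v` to `v'`
(nodes and edges may be repeated). -/
def IsWalk : V → List E → V → Prop
  | v, [], v' => v = v'
  | v, e :: w, v' => N.tail e = v ∧ IsWalk (N.head e) w v'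

/-- The walks available to commodity `i`. -/
def Walk (i : I) : Type := {w : List E // N.IsWalk (N.source i) w (N.dest i)}

/-- All walk-commodity pairs. -/
def CWalk : Type := Σ i : I, N.Walk i

/-- `f` represents an element of `L₊(H)`. -/
def IsRate (f : ℝ → ℝ) : Prop :=
  IntegrableOn f N.H ∧ ∀ᵐ t ∂(volume.restrict N.H), 0 ≤ f t

/-- Given the traversal times `D`, the time at which a particle that enters the walk `w` at
time `t` reaches the end of `w`. -/
def exitTime (D : E → ℝ → ℝ) : List E → ℝ → ℝ
  | [], t => t
  | e :: w, t => exitTime D w (t + D e t)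

/-- The time at which a particle that enters `w` at time `t` has traversed the first `j` edges
of `w`, i.e. arrives at the tail of the edge with (zero-based) index `j`, or, for `j = |w|`, at
the end of `w`. -/
def arrival (D : E → ℝ → ℝ) (w : List E) (j : ℕ) : ℝ → ℝ :=
  exitTime D (w.take j)

/-- The sum of the edge costs `c` that a particle meets that enters `w` at time `t`, where the
cost of an edge is evaluated at the time of entering this edge. -/
def walkCost (D : E → ℝ → ℝ) (c : E → ℝ → ℝ) (w : List E) (t : ℝ) : ℝ :=
  ∑ j : Fin w.length, c (w.get j) (arrival D w j t)

/-- The volume of the inflow `f` into an edge with traversal time `d` that has left the edge up to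
time `t`, i.e. the integral of `f` over the preimage of `[0, t]` under the exit time function. -/
noncomputable def cumOutflow (f d : ℝ → ℝ) (t : ℝ) : ℝ :=
  ∫ s in {s ∈ N.H | s + d s ∈ Icc 0 t}, f s

/-- The volume of the queue at time `t` of an edge `e` with inflow `f` and traversal time `d`. -/
noncomputable def queue (e : E) (f d : ℝ → ℝ) (t : ℝ) : ℝ :=
  (∫ s in Icc 0 t, f s) - N.cumOutflow f d (t + N.τ e)

/-- `d` is the traversal time of the edge `e` in the Vickrey queuing model for the inflow rate `f`
(which counts as zero outside `H`): `d = τ + q / ν`, the queue `q` is nonnegative, and the outflow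
rate exists and is bounded by the service rate `ν`. For `ν = ∞`, the quotient `q / ν` is zero. -/
structure IsVickreyTime (e : E) (f d : ℝ → ℝ) : Prop where
  time_eq : ∀ t ∈ N.H, d t = N.τ e + N.queue e f d t * (N.ν e)⁻¹.toReal
  queue_nonneg : ∀ t ∈ N.H, 0 ≤ N.queue e f d t
  outflow : ∃ k : ℝ → ℝ, (∀ t, IntegrableOn k (Icc 0 t)) ∧
    (∀ᵐ t ∂(volume.restrict (Ici 0)), 0 ≤ k t ∧ ENNReal.ofReal (k t) ≤ N.ν e) ∧
    ∀ t, 0 ≤ t → N.cumOutflow f d t = ∫ s in Icc 0 t, k s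

/-- `D` is a family of edge traversal times on `H` for the edge flow `g`: on `H'` these are the
(unique) traversal times of the Vickrey model, and they are continued to `H` in an arbitrary
absolutely continuous, nonnegative, first-in first-out way, such that all arrival times at nodes
along walks of the commodities stay in `H`. -/
structure IsTraversalTime (g D : E → ℝ → ℝ) : Prop where
  vickrey : ∀ e, ∃ d : ℝ → ℝ, N.IsVickreyTime e (g e) d ∧ EqOn (D e) d N.H'
  nonneg : ∀ e, ∀ t ∈ N.H, 0 ≤ D e t
  absCont : ∀ e, AbsolutelyContinuousOnInterval (D e) 0 N.tf
  fifo : ∀ e, MonotoneOn (fun t => t + D e t) N.H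
  mapsTo : ∀ (i : I) (w : N.Walk i) (j : ℕ), j ≤ w.1.length → MapsTo (arrival D w.1 j) N.H N.H

open Classical in
/-- The walk flow `h` is admissible and induces the edge flow `g`, where `D` are the edge traversal
times under `g`. -/
structure Induces (h : N.CWalk → ℝ → ℝ) (g D : E → ℝ → ℝ) : Prop where
  isRate_walk : ∀ w, N.IsRate (h w)
  sum_walk : ∀ i, ∀ᵐ t ∂(volume.restrict N.H),
    HasSum (fun w : N.Walk i => h ⟨i, w⟩ t) (N.inflow i t)
  isRate_edge : ∀ e, N.IsRate (g e)
  support : ∀ e, ∀ᵐ t ∂(volume.restrict N.H), t ∉ N.H' → g e t = 0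
  traversal : N.IsTraversalTime g D
  loading : ∀ e, ∀ t ∈ N.H,
    HasSum
      (fun w : N.CWalk => ∑ j : Fin w.2.1.length,
        if w.2.1.get j = e then
          ∫ s in {s ∈ N.H | arrival D w.2.1 j s ∈ Icc 0 t}, h w s
        else 0)
      (∫ s in Icc 0 t, g e s)

/-- The pairing of edge costs `c` with an edge flow `g`. -/
noncomputable def pairing [Fintype E] (c g : E → ℝ → ℝ) : ℝ :=
  ∑ e, ∫ t in N.H, c e t * g e t

/-- `g` minimizes the total travel time among all induced edge flows. -/
def IsSystemOptimal [Fintype E] (g : E → ℝ → ℝ) : Prop :=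
  ∃ h D, N.Induces h g D ∧
    ∀ h' g' D', N.Induces h' g' D' → N.pairing D g ≤ N.pairing D' g'

/-- Wardrop's first principle for the walk flow `h` under traversal times `D` and tolls `p`: almost
all particles minimize the sum of their weighted travel time and their tolls. -/
def IsEquilibrium (h : N.CWalk → ℝ → ℝ) (D p : E → ℝ → ℝ) : Prop :=
  ∀ (i : I) (w : N.Walk i), ∀ᵐ t ∂(volume.restrict N.H), 0 < h ⟨i, w⟩ t →
    ∀ w' : N.Walk i,
      N.vot i * walkCost D D w.1 t + walkCost D p w.1 t ≤
        N.vot i * walkCost D D w'.1 t + walkCost D p w'.1 t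

/-- `g` is implementable by anonymous, nonnegative, finite, time-dependent edge tolls `p` with
finite total toll payments. -/
def IsImplementable (g : E → ℝ → ℝ) : Prop :=
  ∃ (h : N.CWalk → ℝ → ℝ) (D p : E → ℝ → ℝ), N.Induces h g D ∧
    (∀ e, ∀ t ∈ N.H, 0 ≤ p e t) ∧
    (∀ e, IntegrableOn (fun t => p e t * g e t) N.H) ∧
    N.IsEquilibrium h D p

end VickreyNetwork

/-- The seven nodes, named after the sources and destinations they carry. -/
inductive FigNode
  | s1 | s2d1 | s3d2 | s4 | s5 | d5 | d3d4

/-- The seven edges. -/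
inductive FigEdge
  | e1 | e2 | e3 | e4 | e5 | e6 | e7
  deriving DecidableEq

instance : Fintype FigEdge where
  elems := {.e1, .e2, .e3, .e4, .e5, .e6, .e7}
  complete := fun x => by cases x <;> simp

/-- The five commodities. -/
inductive FigComm
  | c1 | c2 | c3 | c4 | c5

open FigNode in
/-- The 5-commodity network with parameters `M` and `ε` and horizons `tf' < tf`. -/
noncomputable def figNetwork (M ε tf' tf : ℝ) : VickreyNetwork FigNode FigEdge FigComm where
  tail
    | .e1 => s4
    | .e2 => d5
    | .e3 => s3d2
    | .e4 => s5
    | .e5 => s2d1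
    | .e6 => d5
    | .e7 => s1
  head
    | .e1 => d5
    | .e2 => s3d2
    | .e3 => d3d4
    | .e4 => d5
    | .e5 => s5
    | .e6 => s2d1
    | .e7 => s2d1
  τ
    | .e1 => 1
    | .e2 => 1
    | .e3 => ε
    | .e4 => ε
    | .e5 => 2 - ε
    | .e6 => 4
    | .e7 => 1
  ν
    | .e1 => 1
    | .e2 => 1
    | .e3 => 1
    | .e4 => 2
    | .e5 => 2
    | .e6 => ⊤
    | .e7 => 6
  source
    | .c1 => s1
    | .c2 => s2d1
    | .c3 => s3d2
    | .c4 => s4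
    | .c5 => s5
  dest
    | .c1 => s2d1
    | .c2 => s3d2
    | .c3 => d3d4
    | .c4 => d3d4
    | .c5 => d5
  inflow
    | .c1 => (Icc 0 1).indicator fun _ => 6
    | .c2 => (Icc 2 3).indicator fun _ => 2
    | .c3 => (Icc 7 (10 + M)).indicator fun _ => 1
    | .c4 => (Icc 4 5).indicator fun _ => 1
    | .c5 => (Icc 9 (13 + M)).indicator fun _ => 2
  vot := fun _ => 1
  tf' := tf'
  tf := tf

/-!
Nonnegative tolls never make commodity 1 take more than its single edge `e7`: any other walk
enters `e7` first and then runs around the cycle `e5, e4, e6`, so dropping the loop saves travel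
time and does not increase the tolls. An implementable flow therefore leaves `e5` and `e4` without
a queue when commodity 2 starts, which then meets commodity 4 on `e2` if both go straight. Let `m`
be the total volume of these two commodities that goes straight. As `e2` has rate 1, a volume of
at least `m - 2` of commodity 4 reaches `e3` only after time 7. The diverted volume `3 - m` runs
around the cycle and reaches `e4` only after time 9. From these times on, commodity 3 fills `e3`
and commodity 5 fills `e4` at full rate, so the queues persist until about time `10 + M`. Since
the two volumes add up to 1, the total travel time grows at least like `M`.

If, in contrast, commodity 1 does run once around the cycle, then it delays commodity 2 on `e5`
just long enough for commodity 4 to pass `e2` first. All of commodity 4 then reaches `e3` by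
time 7, no queue survives into the long phase, and the total travel time exceeds the free flow
terms proportional to `ε * M` by a constant only. So for large `M` no system optimum is
implementable.
-/

theorem setIntegral_Icc_sub_setIntegral_Icc {μ : Measure ℝ} {f : ℝ → ℝ} {a s t : ℝ}
    (hf : IntegrableOn f (Icc a t) μ) (has : a ≤ s) (hst : s ≤ t) :
    (∫ u in Icc a t, f u ∂μ) - ∫ u in Icc a s, f u ∂μ = ∫ u in Ioc s t, f u ∂μ := by
  have hdiff : Icc a t \ Icc a s = Ioc s t := by
    ext u
    simp only [mem_sdiff, mem_Icc, mem_Ioc, not_and, not_le]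
    exact ⟨fun hu => ⟨hu.2 hu.1.1, hu.1.2⟩, fun hu => ⟨⟨has.trans hu.1.le, hu.2⟩, fun _ => hu.1⟩⟩
  rw [← hdiff, setIntegral_sdiff measurableSet_Icc hf (Icc_subset_Icc_right hst)]

theorem setIntegral_congr_of_ne_zero {α F : Type*} [MeasurableSpace α] {μ : Measure α}
    [NormedAddCommGroup F] [NormedSpace ℝ F] {f : α → F} {A B : Set α} (hA : MeasurableSet A)
    (hB : MeasurableSet B) (hAB : ∀ᵐ s ∂μ, f s ≠ 0 → (s ∈ A ↔ s ∈ B)) :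
    ∫ s in A, f s ∂μ = ∫ s in B, f s ∂μ := by
  rw [← integral_indicator hA, ← integral_indicator hB]
  refine integral_congr_ae ?_
  filter_upwards [hAB] with s hs
  by_cases hfs : f s = 0
  · simp [indicator, hfs]
  · by_cases hsB : s ∈ B <;> simp [indicator, hs hfs, hsB]

theorem setIntegral_Icc_indicator {a b : ℝ} (c t : ℝ) (ha : 0 ≤ a) :
    ∫ s in Icc 0 t, (Icc a b).indicator (fun _ => c) s = c * max 0 (min t b - a) := by
  rw [setIntegral_indicator measurableSet_Icc, Icc_inter_Icc, max_eq_right ha]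
  simp [mul_comm, max_comm]

theorem setIntegral_Icc_indicator_sub_le {a b c s t : ℝ} (ha : 0 ≤ a) (hc : 0 ≤ c)
    (hst : s ≤ t) :
    (∫ u in Icc 0 t, (Icc a b).indicator (fun _ => c) u) -
      (∫ u in Icc 0 s, (Icc a b).indicator (fun _ => c) u) ≤ c * (t - s) := by
  rw [setIntegral_Icc_indicator c t ha, setIntegral_Icc_indicator c s ha, ← mul_sub]
  exact mul_le_mul_of_nonneg_left (by grind) hc

theorem integrable_indicator_Icc (a b c : ℝ) : Integrable ((Icc a b).indicator fun _ => c) :=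
  (integrable_indicator_iff measurableSet_Icc).2 (by simp)

theorem setIntegral_Icc_eq_of_forall_neg_eq_zero {f : ℝ → ℝ} {a b : ℝ}
    (hf : ∀ t, t < 0 → f t = 0) (ha : a ≤ 0) :
    ∫ s in Icc a b, f s = ∫ s in Icc 0 b, f s :=
  setIntegral_eq_of_subset_of_forall_sdiff_eq_zero measurableSet_Icc (Icc_subset_Icc_left ha)
    fun s hs => hf s (not_le.1 fun hs0 => hs.2 ⟨hs0, hs.1.2⟩)

theorem lipschitzWith_mul_add (a b : ℝ) : LipschitzWith ‖a‖₊ fun t : ℝ => a * t + b :=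
  LipschitzWith.of_dist_le_mul fun x y => by simp [Real.dist_eq, ← mul_sub, abs_mul]

namespace VickreyNetwork

section Vickrey

variable {V E I : Type} {N : VickreyNetwork V E I} {e : E} {f d : ℝ → ℝ} {c : ℝ}

theorem measurableSet_H : MeasurableSet N.H := measurableSet_Icc

theorem IsRate.setIntegral_mono_set (hf : N.IsRate f) {A B : Set ℝ} (hAB : A ⊆ B) (hB : B ⊆ N.H) :
    ∫ s in A, f s ≤ ∫ s in B, f s :=
  MeasureTheory.setIntegral_mono_set (hf.1.mono_set hB)
    (ae_restrict_of_ae_restrict_of_subset hB hf.2) hAB.eventuallyLE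

theorem IsRate.setIntegral_nonneg (hf : N.IsRate f) {A : Set ℝ} (hA : A ⊆ N.H) :
    0 ≤ ∫ s in A, f s :=
  integral_nonneg_of_ae (ae_restrict_of_ae_restrict_of_subset hA hf.2)

namespace IsVickreyTime

theorem cumOutflow_nonneg (hd : N.IsVickreyTime e f d) {t : ℝ} (ht : 0 ≤ t) :
    0 ≤ N.cumOutflow f d t := by
  obtain ⟨k, -, hkν, hF⟩ := hd.outflow
  rw [hF t ht]
  exact integral_nonneg_of_ae ((ae_restrict_of_ae_restrict_of_subset
    Icc_subset_Ici_self hkν).mono fun _ hx => hx.1)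

theorem cumOutflow_sub_le (hd : N.IsVickreyTime e f d) (hν : N.ν e = ENNReal.ofReal c)
    (hc : 0 ≤ c) {s t : ℝ} (hs : 0 ≤ s) (hst : s ≤ t) :
    N.cumOutflow f d t - N.cumOutflow f d s ≤ c * (t - s) := by
  obtain ⟨k, hk, hkν, hF⟩ := hd.outflow
  rw [hF s hs, hF t (hs.trans hst), setIntegral_Icc_sub_setIntegral_Icc (hk t) hs hst]
  have hsub : Ioc s t ⊆ Ici 0 := fun x hx => hs.trans hx.1.le
  calc ∫ u in Ioc s t, k u ≤ ∫ _ in Ioc s t, c := by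
        refine setIntegral_mono_ae_restrict ((hk t).mono_set fun x hx => ⟨hsub hx, hx.2⟩)
          (by simp) ((ae_restrict_of_ae_restrict_of_subset hsub hkν).mono fun x hx => ?_)
        exact (ENNReal.ofReal_le_ofReal_iff hc).1 (hν ▸ hx.2)
    _ = c * (t - s) := by simp [hst, mul_comm]

theorem le_queue (hd : N.IsVickreyTime e f d) (hν : N.ν e = ENNReal.ofReal c) (hc : 0 ≤ c)
    (hτ : 0 ≤ N.τ e) {s t : ℝ} (hs : 0 ≤ s) (hst : s ≤ t) (ht : t ≤ N.tf) :
    (∫ u in Icc 0 t, f u) - (∫ u in Icc 0 s, f u) - c * (t - s) ≤ N.queue e f d t := by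
  have houtflow := hd.cumOutflow_sub_le hν hc (add_nonneg hs hτ)
    (by linarith : s + N.τ e ≤ t + N.τ e)
  have hqueue := hd.queue_nonneg s ⟨hs, hst.trans ht⟩
  unfold queue at *
  linarith

theorem queue_le (hd : N.IsVickreyTime e f d) (hτ : 0 ≤ N.τ e) {t : ℝ} (ht : 0 ≤ t) :
    N.queue e f d t ≤ ∫ u in Icc 0 t, f u :=
  sub_le_self _ (hd.cumOutflow_nonneg (add_nonneg ht hτ))

theorem time_eq_div (hd : N.IsVickreyTime e f d) (hν : N.ν e = ENNReal.ofReal c) (hc : 0 < c)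
    {t : ℝ} (ht : t ∈ N.H) : d t = N.τ e + N.queue e f d t / c := by
  rw [hd.time_eq t ht, hν, ENNReal.toReal_inv, ENNReal.toReal_ofReal hc.le, div_eq_mul_inv]

theorem τ_le (hd : N.IsVickreyTime e f d) {t : ℝ} (ht : t ∈ N.H) : N.τ e ≤ d t := by
  rw [hd.time_eq t ht]
  exact le_add_of_nonneg_right (mul_nonneg (hd.queue_nonneg t ht) ENNReal.toReal_nonneg)

theorem exit_mono (hd : N.IsVickreyTime e f d) (hf : N.IsRate f) (hν : N.ν e = ENNReal.ofReal c)
    (hc : 0 < c) (hτ : 0 ≤ N.τ e) {s t : ℝ} (hs : 0 ≤ s) (hst : s ≤ t) (ht : t ≤ N.tf) :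
    s + d s ≤ t + d t := by
  rw [hd.time_eq_div hν hc ⟨hs, hst.trans ht⟩, hd.time_eq_div hν hc ⟨hs.trans hst, ht⟩]
  have houtflow := hd.cumOutflow_sub_le hν hc.le (add_nonneg hs hτ)
    (by linarith : s + N.τ e ≤ t + N.τ e)
  have hinflow := hf.setIntegral_mono_set (Icc_subset_Icc_right hst) (Icc_subset_Icc_right ht)
  have hqueue : N.queue e f d s - c * (t - s) ≤ N.queue e f d t := by
    unfold queue
    linarith
  have hdelay : (N.queue e f d s - c * (t - s)) / c ≤ N.queue e f d t / c := by gcongr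
  rw [sub_div, mul_div_cancel_left₀ _ hc.ne'] at hdelay
  linarith

theorem le_cumOutflow_exit (hd : N.IsVickreyTime e f d) (hf : N.IsRate f)
    (hν : N.ν e = ENNReal.ofReal c) (hc : 0 < c) (hτ : 0 ≤ N.τ e) {t : ℝ} (ht : t ≤ N.tf) :
    ∫ u in Icc 0 t, f u ≤ N.cumOutflow f d (t + d t) := by
  refine hf.setIntegral_mono_set (fun s hs => ?_) fun _ hs => hs.1
  have hsH : s ∈ N.H := ⟨hs.1, hs.2.trans ht⟩
  exact ⟨hsH, add_nonneg hs.1 (hτ.trans (hd.τ_le hsH)), hd.exit_mono hf hν hc hτ hs.1 hs.2 ht⟩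

theorem continuousOn_queue (hd : N.IsVickreyTime e f d) (hf : N.IsRate f) (hτ : 0 ≤ N.τ e) :
    ContinuousOn (N.queue e f d) N.H := by
  obtain ⟨k, hk, -, hF⟩ := hd.outflow
  have houtflow : ContinuousOn (N.cumOutflow f d) (Icc 0 (N.tf + N.τ e)) :=
    (intervalIntegral.continuousOn_primitive_Icc (hk _)).congr fun t ht => hF t ht.1
  exact (intervalIntegral.continuousOn_primitive_Icc (a := 0) (b := N.tf) hf.1).sub
    (houtflow.comp (by fun_prop) fun t ht => ⟨add_nonneg ht.1 hτ, by simpa using ht.2⟩)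

theorem exists_exit_eq (hd : N.IsVickreyTime e f d) (hf : N.IsRate f)
    (hν : N.ν e = ENNReal.ofReal c) (hc : 0 < c) (hτ : 0 ≤ N.τ e) {t : ℝ} (ht : t ∈ N.H) :
    ∃ x ∈ Icc 0 t, x + d x = t + N.τ e := by
  have h0 : (0 : ℝ) ∈ N.H := ⟨le_rfl, ht.1.trans ht.2⟩
  have hqueue0 : N.queue e f d 0 = 0 :=
    le_antisymm ((hd.queue_le hτ le_rfl).trans (by simp)) (hd.queue_nonneg 0 h0)
  have hcont : ContinuousOn (fun x => x + d x) (Icc 0 t) := by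
    have hexit : ContinuousOn (fun x => x + (N.τ e + N.queue e f d x / c)) (Icc 0 t) :=
      continuousOn_id.add (continuousOn_const.add
        (((hd.continuousOn_queue hf hτ).mono (Icc_subset_Icc_right ht.2)).div_const c))
    exact hexit.congr fun x hx => by simp [hd.time_eq_div hν hc ⟨hx.1, hx.2.trans ht.2⟩]
  refine intermediate_value_Icc ht.1 hcont ⟨?_, ?_⟩
  · simp [hd.time_eq_div hν hc h0, hqueue0, ht.1]
  · simpa using hd.τ_le ht

/-- The particle that leaves the waiting queue at time `t` entered at a time `x` with
`c * (t - x) = q x`, and `q t`, the inflow since then, is at most `c * (t - x)`. So queues can only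
get longer along the steps from `t` to `x`, each of which goes back by at least `q t / c`. -/
theorem queue_eq_zero (hd : N.IsVickreyTime e f d) (hf : N.IsRate f)
    (hν : N.ν e = ENNReal.ofReal c) (hc : 0 < c) (hτ : 0 ≤ N.τ e) {b : ℝ} (hb : b ≤ N.tf)
    (hinflow : ∀ s t, 0 ≤ s → s ≤ t → t ≤ b →
      (∫ u in Icc 0 t, f u) - (∫ u in Icc 0 s, f u) ≤ c * (t - s))
    {t : ℝ} (ht : t ∈ Icc 0 b) : N.queue e f d t = 0 := by
  refine le_antisymm ?_ (hd.queue_nonneg t ⟨ht.1, ht.2.trans hb⟩)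
  by_contra! hpos
  have hback : ∀ n : ℕ, ∀ s ∈ Icc 0 b, N.queue e f d t ≤ N.queue e f d s →
      n * N.queue e f d t ≤ c * s := by
    intro n
    induction n with
    | zero => exact fun s hs _ => by simpa using mul_nonneg hc.le hs.1
    | succ n ih =>
      intro s hs hle
      obtain ⟨x, hx, hexit⟩ := hd.exists_exit_eq hf hν hc hτ ⟨hs.1, hs.2.trans hb⟩
      have hxH : x ∈ N.H := ⟨hx.1, hx.2.trans (hs.2.trans hb)⟩
      have hqueue : N.queue e f d x = c * (s - x) := by
        rw [hd.time_eq_div hν hc hxH] at hexit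
        field_simp at hexit
        linarith
      have hout := hd.le_cumOutflow_exit hf hν hc hτ hxH.2
      rw [hexit] at hout
      have hgrow : N.queue e f d s ≤ N.queue e f d x := by
        rw [hqueue, queue]
        linarith [hinflow x s hx.1 hx.2 hs.2]
      have := ih x ⟨hx.1, hx.2.trans hs.2⟩ (hle.trans hgrow)
      push_cast
      linarith
  obtain ⟨n, hn⟩ := exists_nat_gt (c * t / N.queue e f d t)
  rw [div_lt_iff₀ hpos] at hn
  linarith [hback n t ht le_rfl]

end IsVickreyTime

end Vickrey

section Walks

variable {V E I : Type} {N : VickreyNetwork V E I} {u v v' : V} {w : List E} {e : E}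

theorem IsWalk.mem_of_cut (U : Set V) (hw : N.IsWalk v w v')
    (hcut : ∀ e', N.tail e' ∈ U → N.head e' ∉ U → e' = e) (hv : v ∈ U) (hv' : v' ∉ U) :
    e ∈ w := by
  induction w generalizing v with
  | nil => exact absurd ((hw : v = v') ▸ hv) hv'
  | cons e' w ih =>
    by_cases hhead : N.head e' ∈ U
    · exact List.mem_cons_of_mem _ (ih hw.2 hhead)
    · exact hcut e' (hw.1 ▸ hv) hhead ▸ List.mem_cons_self

theorem IsWalk.eq_nil_or_exists_eq_cons (hw : N.IsWalk v w v')
    (hout : ∀ e', N.tail e' = v → e' = e) :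
    w = [] ∨ ∃ w', w = e :: w' ∧ N.IsWalk (N.head e) w' v' := by
  cases w with
  | nil => exact .inl rfl
  | cons e' w =>
    obtain rfl := hout e' hw.1
    exact .inr ⟨w, rfl, hw.2⟩

theorem IsWalk.exists_eq_cons (hw : N.IsWalk v w v') (hvv' : v ≠ v')
    (hout : ∀ e', N.tail e' = v → e' = e) : ∃ w', w = e :: w' ∧ N.IsWalk (N.head e) w' v' := by
  refine (hw.eq_nil_or_exists_eq_cons hout).resolve_left ?_
  rintro rfl
  exact hvv' hw

theorem IsWalk.eq_nil (hw : N.IsWalk v w v') (hout : ∀ e, N.tail e ≠ v) : w = [] := by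
  cases w with
  | nil => rfl
  | cons e w => exact absurd hw.1 (hout e)

end Walks

section Arrival

variable {V E I : Type} {N : VickreyNetwork V E I} {g D : E → ℝ → ℝ} {f : ℝ → ℝ} {i : I}

theorem exitTime_append (D : E → ℝ → ℝ) (w₁ w₂ : List E) (t : ℝ) :
    exitTime D (w₁ ++ w₂) t = exitTime D w₂ (exitTime D w₁ t) := by
  induction w₁ generalizing t with
  | nil => rfl
  | cons _ _ ih => exact ih _

theorem arrival_succ (D : E → ℝ → ℝ) (w : List E) {j : ℕ} (hj : j < w.length) (t : ℝ) :
    arrival D w (j + 1) t = arrival D w j t + D w[j] (arrival D w j t) := by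
  unfold arrival
  rw [List.take_succ_eq_append_getElem hj, exitTime_append]
  rfl

theorem walkCost_cons (D c : E → ℝ → ℝ) (e : E) (w : List E) (t : ℝ) :
    walkCost D c (e :: w) t = c e t + walkCost D c w (t + D e t) := by
  unfold walkCost
  exact Fin.sum_univ_succ (n := w.length) fun j : Fin (e :: w).length =>
    c ((e :: w).get j) (arrival D (e :: w) j t)

namespace IsTraversalTime

theorem continuousOn (hD : N.IsTraversalTime g D) (e : E) : ContinuousOn (D e) N.H :=
  (hD.absCont e).continuousOn.mono Icc_subset_uIcc

theorem continuousOn_arrival (hD : N.IsTraversalTime g D) (w : N.Walk i) {j : ℕ}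
    (hj : j ≤ w.1.length) : ContinuousOn (arrival D w.1 j) N.H := by
  induction j with
  | zero => exact continuousOn_id
  | succ j ih =>
    have hprev := ih (by omega)
    refine (hprev.add ((hD.continuousOn w.1[j]).comp hprev (hD.mapsTo i w j (by omega)))).congr ?_
    exact fun t _ => arrival_succ D w.1 (by omega) t

theorem arrival_le_arrival (hD : N.IsTraversalTime g D) (w : N.Walk i) {j k : ℕ} (hjk : j ≤ k)
    (hk : k ≤ w.1.length) {s : ℝ} (hs : s ∈ N.H) : arrival D w.1 j s ≤ arrival D w.1 k s := by
  induction k, hjk using Nat.le_induction with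
  | base => exact le_rfl
  | succ k _ ih =>
    refine (ih (by omega)).trans ?_
    rw [arrival_succ D w.1 (by omega)]
    exact le_add_of_nonneg_right (hD.nonneg _ _ (hD.mapsTo i w k (by omega) hs))

theorem le_arrival (hD : N.IsTraversalTime g D) (w : N.Walk i) {j : ℕ} (hj : j ≤ w.1.length)
    {s : ℝ} (hs : s ∈ N.H) : s ≤ arrival D w.1 j s :=
  hD.arrival_le_arrival w (Nat.zero_le j) hj hs

theorem add_le_walkCost (hD : N.IsTraversalTime g D) {c : E → ℝ → ℝ}
    (hc : ∀ e, ∀ t ∈ N.H, 0 ≤ c e t) (w : N.Walk i) {e₁ e₂ : E} {w' : List E}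
    (hw : w.1 = e₁ :: e₂ :: w') {s : ℝ} (hs : s ∈ N.H) :
    c e₁ s + c e₂ (s + D e₁ s) ≤ walkCost D c w.1 s := by
  rw [hw, walkCost_cons, walkCost_cons, ← add_assoc]
  refine le_add_of_nonneg_right (Finset.sum_nonneg fun j _ => hc _ _ ?_)
  have hmaps := hD.mapsTo i w (j + 2) (by simp [hw, j.2.le]) hs
  rwa [hw] at hmaps

theorem τ_le (hD : N.IsTraversalTime g D) (htf : N.tf' ≤ N.tf) (e : E) {t : ℝ}
    (ht : t ∈ N.H') : N.τ e ≤ D e t := by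
  obtain ⟨d, hd, hDd⟩ := hD.vickrey e
  rw [hDd ht]
  exact hd.τ_le ⟨ht.1, ht.2.trans htf⟩

theorem add_mul_le_arrival (hD : N.IsTraversalTime g D) (htf : N.tf' ≤ N.tf) (w : N.Walk i)
    {φ : V → ℝ} (hφ : ∀ v, 0 ≤ φ v) {δ : ℝ}
    (hδ : ∀ e, δ + φ (N.head e) ≤ N.τ e + φ (N.tail e)) {k : ℕ} (hk : k ≤ w.1.length) {s : ℝ}
    (hs : s ∈ N.H) (harr : arrival D w.1 k s ≤ N.tf') :
    s + k * δ ≤ arrival D w.1 k s + φ (N.source i) := by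
  suffices ∃ u, N.IsWalk u (w.1.drop k) (N.dest i) ∧
      s + k * δ + φ u ≤ arrival D w.1 k s + φ (N.source i) by
    obtain ⟨u, -, hu⟩ := this
    linarith [hφ u]
  induction k with
  | zero => exact ⟨_, w.2, by simp [arrival, exitTime]⟩
  | succ k ih =>
    have hmono := (hD.arrival_le_arrival w (Nat.le_succ k) hk hs).trans harr
    obtain ⟨u, hu, hle⟩ := ih (by omega) hmono
    rw [List.drop_eq_getElem_cons hk] at hu
    obtain ⟨rfl, hu⟩ := hu
    refine ⟨_, hu, ?_⟩
    have hτ := hD.τ_le htf w.1[k] ⟨(hD.mapsTo i w k (by omega) hs).1, hmono⟩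
    rw [arrival_succ D w.1 hk]
    push_cast
    linarith [hδ w.1[k]]

theorem le_time (hD : N.IsTraversalTime g D) (htf : N.tf' ≤ N.tf) {e : E} {c : ℝ}
    (hν : N.ν e = ENNReal.ofReal c) (hc : 0 < c) (hτ : 0 ≤ N.τ e) {s t : ℝ} (hs : 0 ≤ s)
    (hst : s ≤ t) (ht : t ≤ N.tf') :
    N.τ e + ((∫ u in Icc 0 t, g e u) - (∫ u in Icc 0 s, g e u) - c * (t - s)) / c ≤ D e t := by
  obtain ⟨d, hd, hDd⟩ := hD.vickrey e
  rw [hDd ⟨hs.trans hst, ht⟩, hd.time_eq_div hν hc ⟨hs.trans hst, ht.trans htf⟩]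
  have := hd.le_queue hν hc.le hτ hs hst (ht.trans htf)
  gcongr

theorem time_eq_τ (hD : N.IsTraversalTime g D) (htf : N.tf' ≤ N.tf) {e : E} {c : ℝ}
    (hg : N.IsRate (g e)) (hν : N.ν e = ENNReal.ofReal c) (hc : 0 < c) (hτ : 0 ≤ N.τ e) {b : ℝ}
    (hb : b ≤ N.tf') (hinflow : ∀ s t, 0 ≤ s → s ≤ t → t ≤ b →
      (∫ u in Icc 0 t, g e u) - (∫ u in Icc 0 s, g e u) ≤ c * (t - s))
    {t : ℝ} (ht : t ∈ Icc 0 b) : D e t = N.τ e := by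
  obtain ⟨d, hd, hDd⟩ := hD.vickrey e
  rw [hDd ⟨ht.1, ht.2.trans hb⟩, hd.time_eq_div hν hc ⟨ht.1, (ht.2.trans hb).trans htf⟩,
    hd.queue_eq_zero hg hν hc hτ (hb.trans htf) hinflow ht]
  simp

theorem le_setIntegral_time_mul (hD : N.IsTraversalTime g D) (htf : N.tf' ≤ N.tf) {e : E}
    (hg : N.IsRate (g e)) (hsupp : ∀ᵐ t ∂(volume.restrict N.H), t ∉ N.H' → g e t = 0)
    {a b δ : ℝ} (ha : 0 ≤ a) (hab : a ≤ b) (hb : b ≤ N.tf)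
    (hδ : ∀ t ∈ Ioc a b, N.τ e + δ ≤ D e t) :
    N.τ e * (∫ t in N.H, g e t) + δ * ((∫ u in Icc 0 b, g e u) - ∫ u in Icc 0 a, g e u) ≤
      ∫ t in N.H, D e t * g e t := by
  have hsub : Ioc a b ⊆ N.H := fun t ht => ⟨ha.trans ht.1.le, ht.2.trans hb⟩
  have hfree : IntegrableOn (fun t => N.τ e * g e t) N.H := hg.1.const_mul _
  have hdelay : IntegrableOn ((Ioc a b).indicator fun t => δ * g e t) N.H :=
    (hg.1.const_mul δ).indicator measurableSet_Ioc
  calc N.τ e * (∫ t in N.H, g e t) + δ * ((∫ u in Icc 0 b, g e u) - ∫ u in Icc 0 a, g e u)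
      = ∫ t in N.H, (N.τ e * g e t + (Ioc a b).indicator (fun t => δ * g e t) t) := by
        rw [integral_add hfree hdelay, setIntegral_indicator measurableSet_Ioc,
          inter_eq_self_of_subset_right hsub, integral_const_mul, integral_const_mul,
          setIntegral_Icc_sub_setIntegral_Icc (hg.1.mono_set (Icc_subset_Icc_right hb)) ha hab]
    _ ≤ ∫ t in N.H, D e t * g e t := by
        refine setIntegral_mono_ae_restrict (hfree.add hdelay)
          (hg.1.continuousOn_mul (hD.continuousOn e) isCompact_Icc) ?_
        filter_upwards [hg.2, hsupp] with t hgt hgsupp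
        by_cases htH' : t ∈ N.H'
        · by_cases htab : t ∈ Ioc a b
          · simp only [htab, indicator_of_mem]
            nlinarith [hδ t htab]
          · simp only [htab, not_false_eq_true, indicator_of_notMem, add_zero]
            exact mul_le_mul_of_nonneg_right (hD.τ_le htf e htH') hgt
        · simp [hgsupp htH', indicator]

end IsTraversalTime

end Arrival

section Mass

variable {V E I : Type} {N : VickreyNetwork V E I} {g D : E → ℝ → ℝ} {f : ℝ → ℝ} {i : I}

/-- The volume of the walk inflow `f` that has traversed the first `j` edges of `w` up to time
`t`. -/
noncomputable def arrivedMass (N : VickreyNetwork V E I) (D : E → ℝ → ℝ) (f : ℝ → ℝ) (w : List E)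
    (j : ℕ) (t : ℝ) : ℝ :=
  ∫ s in {s ∈ N.H | arrival D w j s ∈ Icc 0 t}, f s

open Classical in
/-- The volume with which the walk inflow `f` into `w` has entered the edge `e` up to time `t`,
counted once for each visit of `e`. -/
noncomputable def edgeMass (N : VickreyNetwork V E I) (D : E → ℝ → ℝ) (f : ℝ → ℝ) (w : List E)
    (e : E) (t : ℝ) : ℝ :=
  ∑ j : Fin w.length, if w.get j = e then N.arrivedMass D f w j t else 0

theorem IsRate.arrivedMass_nonneg (hf : N.IsRate f) (w : List E) (j : ℕ) (t : ℝ) :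
    0 ≤ N.arrivedMass D f w j t :=
  hf.setIntegral_nonneg fun _ hs => hs.1

theorem IsRate.arrivedMass_mono (hf : N.IsRate f) (w : List E) (j : ℕ) {t₁ t₂ : ℝ}
    (ht : t₁ ≤ t₂) : N.arrivedMass D f w j t₁ ≤ N.arrivedMass D f w j t₂ :=
  hf.setIntegral_mono_set (fun _ hs => ⟨hs.1, hs.2.1, hs.2.2.trans ht⟩) fun _ hs => hs.1

theorem arrivedMass_zero (w : List E) {t : ℝ} (ht : t ≤ N.tf) :
    N.arrivedMass D f w 0 t = ∫ s in Icc 0 t, f s := by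
  have hset : {s ∈ N.H | arrival D w 0 s ∈ Icc 0 t} = Icc 0 t :=
    inter_eq_self_of_subset_right (Icc_subset_Icc_right ht)
  rw [arrivedMass, hset]

namespace IsTraversalTime

theorem measurableSet_arrived (hD : N.IsTraversalTime g D) (w : N.Walk i) {j : ℕ}
    (hj : j ≤ w.1.length) (t : ℝ) : MeasurableSet {s ∈ N.H | arrival D w.1 j s ∈ Icc 0 t} :=
  ((hD.continuousOn_arrival w hj).preimage_isClosed_of_isClosed isClosed_Icc
    isClosed_Icc).measurableSet

theorem arrivedMass_eq (hD : N.IsTraversalTime g D) (w : N.Walk i) {j : ℕ}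
    (hj : j ≤ w.1.length) {t : ℝ} {S : Set ℝ} (hS : MeasurableSet S) (hSH : S ⊆ N.H)
    (hfS : ∀ᵐ s ∂(volume.restrict N.H), f s ≠ 0 → (arrival D w.1 j s ≤ t ↔ s ∈ S)) :
    N.arrivedMass D f w.1 j t = ∫ s in S, f s := by
  refine setIntegral_congr_of_ne_zero (hD.measurableSet_arrived w hj t) hS ?_
  filter_upwards [(ae_restrict_iff' measurableSet_H).1 hfS] with s hs hfs
  by_cases hsH : s ∈ N.H
  · rw [← hs hsH hfs]
    exact ⟨fun h => h.2.2, fun h => ⟨hsH, (hD.mapsTo i w j hj hsH).1, h⟩⟩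
  · exact iff_of_false (fun h => hsH h.1) fun h => hsH (hSH h)

theorem arrivedMass_eq_mass (hD : N.IsTraversalTime g D) (w : N.Walk i) {j : ℕ}
    (hj : j ≤ w.1.length) {t : ℝ}
    (hft : ∀ᵐ s ∂(volume.restrict N.H), f s ≠ 0 → arrival D w.1 j s ≤ t) :
    N.arrivedMass D f w.1 j t = ∫ s in N.H, f s := by
  refine hD.arrivedMass_eq w hj measurableSet_H subset_rfl ?_
  filter_upwards [hft, ae_restrict_mem measurableSet_H] with s hs hsH hfs
  exact iff_of_true (hs hfs) hsH

theorem arrivedMass_eq_zero (hD : N.IsTraversalTime g D) (w : N.Walk i) {j : ℕ}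
    (hj : j ≤ w.1.length) {t : ℝ}
    (hft : ∀ᵐ s ∂(volume.restrict N.H), f s ≠ 0 → t < arrival D w.1 j s) :
    N.arrivedMass D f w.1 j t = 0 := by
  rw [hD.arrivedMass_eq w hj MeasurableSet.empty (empty_subset _) (t := t) (f := f)]
  · simp
  · filter_upwards [hft] with s hs hfs
    simpa using hs hfs

theorem arrivedMass_tf (hD : N.IsTraversalTime g D) (w : N.Walk i) {j : ℕ}
    (hj : j ≤ w.1.length) : N.arrivedMass D f w.1 j N.tf = ∫ s in N.H, f s := by
  refine hD.arrivedMass_eq_mass w hj ?_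
  filter_upwards [ae_restrict_mem measurableSet_H] with s hsH _
  exact (hD.mapsTo i w j hj hsH).2

theorem arrivedMass_le (hD : N.IsTraversalTime g D) (hf : N.IsRate f) (w : N.Walk i) {j : ℕ}
    (hj : j ≤ w.1.length) {t : ℝ} (ht : t ≤ N.tf) :
    N.arrivedMass D f w.1 j t ≤ ∫ s in Icc 0 t, f s :=
  hf.setIntegral_mono_set (fun _ hs => ⟨hs.1.1, (hD.le_arrival w hj hs.1).trans hs.2.2⟩)
    (Icc_subset_Icc_right ht)

end IsTraversalTime

namespace IsRate

theorem edgeMass_mono (hf : N.IsRate f) {w : List E} {e : E} {t₁ t₂ : ℝ} (ht : t₁ ≤ t₂) :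
    N.edgeMass D f w e t₁ ≤ N.edgeMass D f w e t₂ := by
  unfold edgeMass
  gcongr with j
  split_ifs
  exacts [hf.arrivedMass_mono w _ ht, le_rfl]

theorem edgeMass_nonneg (hf : N.IsRate f) {w : List E} {e : E} {t : ℝ} :
    0 ≤ N.edgeMass D f w e t := by
  refine Finset.sum_nonneg fun j _ => ?_
  split_ifs
  exacts [hf.arrivedMass_nonneg w _ t, le_rfl]

theorem arrivedMass_sub_le_edgeMass_sub (hf : N.IsRate f) {w : List E} {j : ℕ}
    (hj : j < w.length) {e : E} (he : w[j] = e) {t₁ t₂ : ℝ} (ht : t₁ ≤ t₂) :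
    N.arrivedMass D f w j t₂ - N.arrivedMass D f w j t₁ ≤
      N.edgeMass D f w e t₂ - N.edgeMass D f w e t₁ := by
  classical
  unfold edgeMass
  rw [← Finset.sum_sub_distrib]
  have := Finset.single_le_sum (s := Finset.univ) (f := fun j : Fin w.length =>
    (if w.get j = e then N.arrivedMass D f w j t₂ else 0) -
      (if w.get j = e then N.arrivedMass D f w j t₁ else 0)) (fun k _ => ?_)
    (Finset.mem_univ (⟨j, hj⟩ : Fin w.length))
  · simpa [he] using this
  · split_ifs
    · exact sub_nonneg.2 (hf.arrivedMass_mono w _ ht)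
    · simp

theorem arrivedMass_le_edgeMass (hf : N.IsRate f) {w : List E} {j : ℕ} (hj : j < w.length)
    {e : E} (he : w[j] = e) (t : ℝ) : N.arrivedMass D f w j t ≤ N.edgeMass D f w e t := by
  classical
  have := Finset.single_le_sum (s := Finset.univ) (f := fun j : Fin w.length =>
    (if w.get j = e then N.arrivedMass D f w j t else 0)) (fun k _ => ?_)
    (Finset.mem_univ (⟨j, hj⟩ : Fin w.length))
  · simpa [edgeMass, he] using this
  · split_ifs
    exacts [hf.arrivedMass_nonneg w _ t, le_rfl]

end IsRate

theorem edgeMass_eq_arrivedMass {w : List E} {j : ℕ} (hj : j < w.length) {e : E} (he : w[j] = e)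
    {t : ℝ} (hother : ∀ k (hk : k < w.length), k ≠ j → w[k] = e → N.arrivedMass D f w k t = 0) :
    N.edgeMass D f w e t = N.arrivedMass D f w j t := by
  unfold edgeMass
  rw [Finset.sum_eq_single (⟨j, hj⟩ : Fin w.length)]
  · simp [he]
  · intro k _ hk
    split_ifs with hke
    exacts [hother k k.2 (fun h => hk (Fin.ext h)) hke, rfl]
  · simp

theorem edgeMass_eq_zero {w : List E} {e : E} {t : ℝ}
    (hzero : ∀ k (hk : k < w.length), w[k] = e → N.arrivedMass D f w k t = 0) :
    N.edgeMass D f w e t = 0 := by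
  refine Finset.sum_eq_zero fun k _ => ?_
  split_ifs with hke
  exacts [hzero k k.2 hke, rfl]

theorem IsTraversalTime.edgeMass_le (hD : N.IsTraversalTime g D) (hf : N.IsRate f)
    (w : N.Walk i) {e : E} {t : ℝ} (ht : t ≤ N.tf) {n : ℕ}
    (hn : ∀ k, k ≤ w.1.length → n ≤ k → ∀ s ∈ N.H, t < arrival D w.1 k s) :
    N.edgeMass D f w.1 e t ≤ n * ∫ s in Icc 0 t, f s := by
  have hmass : 0 ≤ ∫ s in Icc 0 t, f s := hf.setIntegral_nonneg (Icc_subset_Icc_right ht)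
  calc N.edgeMass D f w.1 e t
      ≤ ∑ j : Fin w.1.length, if (j : ℕ) < n then ∫ s in Icc 0 t, f s else 0 := by
        refine Finset.sum_le_sum fun j _ => ?_
        by_cases hjn : (j : ℕ) < n
        · simp only [hjn, if_true]
          split_ifs
          exacts [hD.arrivedMass_le hf w j.2.le ht, hmass]
        · have : N.arrivedMass D f w.1 j t = 0 := by
            refine hD.arrivedMass_eq_zero w j.2.le ?_
            filter_upwards [ae_restrict_mem measurableSet_H] with s hs _
            exact hn j j.2.le (not_lt.1 hjn) s hs
          simp [hjn, this]
    _ = (Finset.univ.filter fun j : Fin w.1.length => (j : ℕ) < n).card *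
          ∫ s in Icc 0 t, f s := by
        rw [← Finset.sum_filter, Finset.sum_const, nsmul_eq_mul]
    _ ≤ n * ∫ s in Icc 0 t, f s := by
        gcongr
        rw [Fin.card_filter_val_lt]
        exact min_le_right _ _

end Mass

section Commodity

variable {V E I : Type} {N : VickreyNetwork V E I} {g D : E → ℝ → ℝ}
  {h : N.CWalk → ℝ → ℝ} {e : E} {i : I} {t : ℝ}

instance [Countable E] (i : I) : Countable (N.Walk i) :=
  inferInstanceAs (Countable {w : List E // N.IsWalk (N.source i) w (N.dest i)})

/-- The volume of commodity `i` that has entered the edge `e` up to time `t` under the walk flow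
`h` with edge traversal times `D`. -/
noncomputable def commodityMass (N : VickreyNetwork V E I) (h : N.CWalk → ℝ → ℝ)
    (D : E → ℝ → ℝ) (i : I) (e : E) (t : ℝ) : ℝ :=
  ∑' w : N.Walk i, N.edgeMass D (h ⟨i, w⟩) w.1 e t

/-- The total volume that the walk flow `h` sends along the walk `w`. -/
noncomputable def walkMass (N : VickreyNetwork V E I) (h : N.CWalk → ℝ → ℝ) (w : N.CWalk) : ℝ :=
  ∫ s in N.H, h w s

namespace Induces

theorem ae_mem_of_ne_zero [Countable E] (hI : N.Induces h g D) {A : Set ℝ}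
    (hA : ∀ᵐ s ∂(volume.restrict N.H), s ∉ A → N.inflow i s = 0) (w : N.Walk i) :
    ∀ᵐ s ∂(volume.restrict N.H), h ⟨i, w⟩ s ≠ 0 → s ∈ A := by
  have hnonneg : ∀ᵐ s ∂(volume.restrict N.H), ∀ w : N.Walk i, 0 ≤ h ⟨i, w⟩ s :=
    ae_all_iff.2 fun w => (hI.isRate_walk ⟨i, w⟩).2
  filter_upwards [hI.sum_walk i, hnonneg, hA] with s hsum hnonneg hsupp hs
  by_contra hsA
  rw [hsupp hsA, hasSum_zero_iff_of_nonneg hnonneg] at hsum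
  exact hs (congrFun hsum w)

theorem hasSum_setIntegral [Countable E] (hI : N.Induces h g D) (i : I)
    (hinflow : IntegrableOn (N.inflow i) N.H) {S : Set ℝ} (hS : S ⊆ N.H) :
    HasSum (fun w : N.Walk i => ∫ s in S, h ⟨i, w⟩ s) (∫ s in S, N.inflow i s) := by
  have hsum := ae_restrict_of_ae_restrict_of_subset hS (hI.sum_walk i)
  refine hasSum_integral_of_dominated_convergence (fun w s => h ⟨i, w⟩ s)
    (fun w => ((hI.isRate_walk _).1.mono_set hS).aestronglyMeasurable) (fun w => ?_) ?_ ?_ hsum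
  · filter_upwards [ae_restrict_of_ae_restrict_of_subset hS (hI.isRate_walk ⟨i, w⟩).2] with s hs
    rw [Real.norm_of_nonneg hs]
  · filter_upwards [hsum] with s hs using hs.summable
  · refine (hinflow.mono_set hS).congr ?_
    filter_upwards [hsum] with s hs using hs.tsum_eq.symm

theorem hasSum_commodityMass (hI : N.Induces h g D) (i : I) (e : E) (ht : t ∈ N.H) :
    HasSum (fun w : N.Walk i => N.edgeMass D (h ⟨i, w⟩) w.1 e t) (N.commodityMass h D i e t) :=
  ((hI.loading e t ht).summable.sigma_factor i).hasSum

theorem sum_commodityMass [Fintype I] (hI : N.Induces h g D) (e : E) (ht : t ∈ N.H) :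
    ∑ i, N.commodityMass h D i e t = ∫ s in Icc 0 t, g e s :=
  (hasSum_fintype _).unique
    ((hI.loading e t ht).sigma fun i => hI.hasSum_commodityMass i e ht)

theorem edgeMass_sub_le_commodityMass_sub (hI : N.Induces h g D) (w : N.Walk i) {t₁ t₂ : ℝ}
    (ht₁ : t₁ ∈ N.H) (ht₂ : t₂ ∈ N.H) (ht : t₁ ≤ t₂) :
    N.edgeMass D (h ⟨i, w⟩) w.1 e t₂ - N.edgeMass D (h ⟨i, w⟩) w.1 e t₁ ≤
      N.commodityMass h D i e t₂ - N.commodityMass h D i e t₁ :=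
  le_hasSum ((hI.hasSum_commodityMass i e ht₂).sub (hI.hasSum_commodityMass i e ht₁)) w
    fun w' _ => sub_nonneg.2 ((hI.isRate_walk ⟨i, w'⟩).edgeMass_mono ht)

theorem commodityMass_nonneg (hI : N.Induces h g D) : 0 ≤ N.commodityMass h D i e t :=
  tsum_nonneg fun w => (hI.isRate_walk ⟨i, w⟩).edgeMass_nonneg

theorem commodityMass_mono (hI : N.Induces h g D) {t₁ t₂ : ℝ} (ht₁ : t₁ ∈ N.H) (ht₂ : t₂ ∈ N.H)
    (ht : t₁ ≤ t₂) : N.commodityMass h D i e t₁ ≤ N.commodityMass h D i e t₂ :=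
  hasSum_le (fun w => (hI.isRate_walk ⟨i, w⟩).edgeMass_mono ht) (hI.hasSum_commodityMass i e ht₁)
    (hI.hasSum_commodityMass i e ht₂)

theorem le_commodityMass (hI : N.Induces h g D) (ht : t ∈ N.H) {m : N.Walk i → ℝ} {S : ℝ}
    (hm : HasSum m S) (hle : ∀ w, m w ≤ N.edgeMass D (h ⟨i, w⟩) w.1 e t) :
    S ≤ N.commodityMass h D i e t :=
  hasSum_le hle hm (hI.hasSum_commodityMass i e ht)

theorem commodityMass_le (hI : N.Induces h g D) (ht : t ∈ N.H) {m : N.Walk i → ℝ} {S : ℝ}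
    (hm : HasSum m S) (hle : ∀ w, N.edgeMass D (h ⟨i, w⟩) w.1 e t ≤ m w) :
    N.commodityMass h D i e t ≤ S :=
  hasSum_le hle (hI.hasSum_commodityMass i e ht) hm

theorem le_commodityMass_sub (hI : N.Induces h g D) {t₁ t₂ : ℝ} (ht₁ : t₁ ∈ N.H)
    (ht₂ : t₂ ∈ N.H) {m : N.Walk i → ℝ} {S : ℝ} (hm : HasSum m S)
    (hle : ∀ w, m w ≤ N.edgeMass D (h ⟨i, w⟩) w.1 e t₂ - N.edgeMass D (h ⟨i, w⟩) w.1 e t₁) :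
    S ≤ N.commodityMass h D i e t₂ - N.commodityMass h D i e t₁ :=
  hasSum_le hle hm ((hI.hasSum_commodityMass i e ht₂).sub (hI.hasSum_commodityMass i e ht₁))

theorem sum_commodityMass_sub_le [Finite I] (hI : N.Induces h g D) (e : E) (s : Finset I)
    {t₁ t₂ : ℝ} (ht₁ : t₁ ∈ N.H) (ht₂ : t₂ ∈ N.H) (ht : t₁ ≤ t₂) :
    ∑ i ∈ s, (N.commodityMass h D i e t₂ - N.commodityMass h D i e t₁) ≤
      (∫ u in Icc 0 t₂, g e u) - ∫ u in Icc 0 t₁, g e u := by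
  have := Fintype.ofFinite I
  rw [← hI.sum_commodityMass e ht₂, ← hI.sum_commodityMass e ht₁, ← Finset.sum_sub_distrib]
  exact Finset.sum_le_sum_of_subset_of_nonneg (Finset.subset_univ s) fun i _ _ =>
    sub_nonneg.2 (hI.commodityMass_mono ht₁ ht₂ ht)

theorem sum_setIntegral_inflow_le [Countable E] [Finite I] (hI : N.Induces h g D)
    (htf : 0 ≤ N.tf) (s : Finset I) (hinflow : ∀ i ∈ s, IntegrableOn (N.inflow i) N.H)
    (hmem : ∀ i ∈ s, ∀ w : N.Walk i, e ∈ w.1) :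
    ∑ i ∈ s, ∫ u in N.H, N.inflow i u ≤ ∫ u in N.H, g e u := by
  have := Fintype.ofFinite I
  have htfH : N.tf ∈ N.H := ⟨htf, le_rfl⟩
  calc ∑ i ∈ s, ∫ u in N.H, N.inflow i u
      ≤ ∑ i ∈ s, N.commodityMass h D i e N.tf := by
        refine Finset.sum_le_sum fun i hi => hI.le_commodityMass htfH
          (hI.hasSum_setIntegral i (hinflow i hi) subset_rfl) fun w => ?_
        obtain ⟨j, hj, hje⟩ := List.getElem_of_mem (hmem i hi w)
        rw [← hI.traversal.arrivedMass_tf w hj.le]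
        exact (hI.isRate_walk ⟨i, w⟩).arrivedMass_le_edgeMass hj hje N.tf
    _ ≤ ∑ i, N.commodityMass h D i e N.tf :=
        Finset.sum_le_sum_of_subset_of_nonneg (Finset.subset_univ s) fun i _ _ =>
          hI.commodityMass_nonneg
    _ = ∫ u in N.H, g e u := hI.sum_commodityMass e htfH

theorem commodityMass_eq_zero (hI : N.Induces h g D)
    (hlt : ∀ (w : N.Walk i) (k : ℕ) (hk : k < w.1.length), w.1[k] = e →
      ∀ᵐ s ∂(volume.restrict N.H), h ⟨i, w⟩ s ≠ 0 → t < arrival D w.1 k s) :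
    N.commodityMass h D i e t = 0 := by
  have hzero : ∀ w : N.Walk i, N.edgeMass D (h ⟨i, w⟩) w.1 e t = 0 := fun w =>
    edgeMass_eq_zero fun k hk hke => hI.traversal.arrivedMass_eq_zero w hk.le (hlt w k hk hke)
  simp only [commodityMass, hzero, tsum_zero]

theorem commodityMass_eq_setIntegral [Countable E] (hI : N.Induces h g D)
    (hinflow : IntegrableOn (N.inflow i) N.H) {j : ℕ} {δ : ℝ} (htδ : t - δ ≤ N.tf)
    (hj : ∀ w : N.Walk i, ∃ hj : j < w.1.length, w.1[j] = e)
    (harr : ∀ w : N.Walk i, ∀ᵐ s ∂(volume.restrict N.H), h ⟨i, w⟩ s ≠ 0 →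
      arrival D w.1 j s = s + δ)
    (hother : ∀ (w : N.Walk i) (k : ℕ) (hk : k < w.1.length), k ≠ j → w.1[k] = e →
      ∀ᵐ s ∂(volume.restrict N.H), h ⟨i, w⟩ s ≠ 0 → t < arrival D w.1 k s) :
    N.commodityMass h D i e t = ∫ s in Icc 0 (t - δ), N.inflow i s := by
  have hsub : Icc 0 (t - δ) ⊆ N.H := Icc_subset_Icc_right htδ
  refine Eq.trans (tsum_congr fun w => ?_) (hI.hasSum_setIntegral i hinflow hsub).tsum_eq
  obtain ⟨hjw, hje⟩ := hj w
  rw [edgeMass_eq_arrivedMass hjw hje fun k hk hkj hke =>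
    hI.traversal.arrivedMass_eq_zero w hk.le (hother w k hk hkj hke)]
  refine hI.traversal.arrivedMass_eq w hjw.le measurableSet_Icc hsub ?_
  filter_upwards [harr w, ae_restrict_mem measurableSet_H] with s hs hsH hne
  rw [hs hne, ← le_sub_iff_add_le]
  exact ⟨fun hst => ⟨hsH.1, hst⟩, fun hst => hst.2⟩

theorem setIntegral_inflow_sub_le_commodityMass_sub [Countable E] (hI : N.Induces h g D)
    (hinflow : IntegrableOn (N.inflow i) N.H) (hhead : ∀ w : N.Walk i, ∃ w', w.1 = e :: w')
    {t₁ t₂ : ℝ} (ht₁ : t₁ ∈ N.H) (ht₂ : t₂ ∈ N.H) (ht : t₁ ≤ t₂) :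
    (∫ s in Icc 0 t₂, N.inflow i s) - (∫ s in Icc 0 t₁, N.inflow i s) ≤
      N.commodityMass h D i e t₂ - N.commodityMass h D i e t₁ := by
  refine hI.le_commodityMass_sub ht₁ ht₂
    ((hI.hasSum_setIntegral i hinflow (Icc_subset_Icc_right ht₂.2)).sub
      (hI.hasSum_setIntegral i hinflow (Icc_subset_Icc_right ht₁.2))) fun w => ?_
  obtain ⟨w', hw⟩ := hhead w
  have hle := (hI.isRate_walk ⟨i, w⟩).arrivedMass_sub_le_edgeMass_sub (D := D) (w := w.1)
    (e := e) (j := 0) (by simp [hw]) (by simp only [hw, List.getElem_cons_zero]) ht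
  rwa [arrivedMass_zero w.1 ht₂.2, arrivedMass_zero w.1 ht₁.2] at hle

theorem hasSum_walkMass [Countable E] (hI : N.Induces h g D) (i : I)
    (hinflow : IntegrableOn (N.inflow i) N.H) :
    HasSum (fun w : N.Walk i => N.walkMass h ⟨i, w⟩) (∫ s in N.H, N.inflow i s) :=
  hI.hasSum_setIntegral i hinflow subset_rfl

theorem walkMass_nonneg (hI : N.Induces h g D) (w : N.CWalk) : 0 ≤ N.walkMass h w :=
  (hI.isRate_walk w).setIntegral_nonneg subset_rfl

theorem walkMass_le [Countable E] (hI : N.Induces h g D) (hinflow : IntegrableOn (N.inflow i) N.H)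
    (w : N.Walk i) : N.walkMass h ⟨i, w⟩ ≤ ∫ s in N.H, N.inflow i s :=
  le_hasSum (hI.hasSum_walkMass i hinflow) w fun w' _ => hI.walkMass_nonneg ⟨i, w'⟩

theorem walkMass_le_edgeMass_sub (hI : N.Induces h g D) (w : N.Walk i) {j : ℕ}
    (hj : j < w.1.length) (he : w.1[j] = e) {t₁ t₂ : ℝ} (ht : t₁ ≤ t₂)
    (harr : ∀ᵐ s ∂(volume.restrict N.H), h ⟨i, w⟩ s ≠ 0 → arrival D w.1 j s ∈ Ioc t₁ t₂) :
    N.walkMass h ⟨i, w⟩ ≤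
      N.edgeMass D (h ⟨i, w⟩) w.1 e t₂ - N.edgeMass D (h ⟨i, w⟩) w.1 e t₁ := by
  have hle := (hI.isRate_walk ⟨i, w⟩).arrivedMass_sub_le_edgeMass_sub (D := D) hj he ht
  rwa [hI.traversal.arrivedMass_eq_mass w hj.le (harr.mono fun s hs hne => (hs hne).2),
    hI.traversal.arrivedMass_eq_zero w hj.le (harr.mono fun s hs hne => (hs hne).1),
    sub_zero] at hle

theorem sub_walkMass_le_commodityMass_sub [Countable E] (hI : N.Induces h g D)
    (hinflow : IntegrableOn (N.inflow i) N.H) (w₀ : N.Walk i) {t₁ t₂ : ℝ}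
    (ht₁ : t₁ ∈ N.H) (ht₂ : t₂ ∈ N.H) (ht : t₁ ≤ t₂)
    (harr : ∀ w, w ≠ w₀ → ∃ (j : ℕ) (hj : j < w.1.length), w.1[j] = e ∧
      ∀ᵐ s ∂(volume.restrict N.H), h ⟨i, w⟩ s ≠ 0 → arrival D w.1 j s ∈ Ioc t₁ t₂) :
    (∫ s in N.H, N.inflow i s) - N.walkMass h ⟨i, w₀⟩ ≤
      N.commodityMass h D i e t₂ - N.commodityMass h D i e t₁ := by
  classical
  have hsum := (hI.hasSum_walkMass i hinflow).update w₀ 0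
  rw [zero_sub, neg_add_eq_sub] at hsum
  refine hI.le_commodityMass_sub ht₁ ht₂ hsum fun w => ?_
  obtain rfl | hw := eq_or_ne w w₀
  · rw [Function.update_self]
    exact sub_nonneg.2 ((hI.isRate_walk ⟨i, w⟩).edgeMass_mono ht)
  · obtain ⟨j, hj, he, hae⟩ := harr w hw
    rw [Function.update_of_ne hw]
    exact hI.walkMass_le_edgeMass_sub w hj he ht hae

end Induces

end Commodity

section Criterion

variable {V E I : Type} {N : VickreyNetwork V E I} {e : E} {D : E → ℝ → ℝ} {f d : ℝ → ℝ}

theorem cumOutflow_eq_setIntegral {t x : ℝ} (hf : ∀ s, N.tf < s → f s = 0)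
    (hd : ∀ s ∈ N.H, 0 ≤ d s) (hx : ∀ s, s + d s ≤ t ↔ s ≤ x) :
    N.cumOutflow f d t = ∫ s in Icc 0 x, f s := by
  have hset : {s ∈ N.H | s + d s ∈ Icc 0 t} = Icc 0 (min x N.tf) := by
    ext s
    constructor
    · rintro ⟨hs, -, hst⟩
      exact ⟨hs.1, le_min ((hx s).1 hst) hs.2⟩
    · rintro ⟨hs0, hs⟩
      have hsH : s ∈ N.H := ⟨hs0, hs.trans (min_le_right _ _)⟩
      exact ⟨hsH, add_nonneg hs0 (hd s hsH), (hx s).2 (hs.trans (min_le_left _ _))⟩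
  rw [cumOutflow, hset]
  exact (setIntegral_eq_of_subset_of_forall_sdiff_eq_zero measurableSet_Icc
    (Icc_subset_Icc_right (min_le_left _ _)) fun s hs => hf s
      (not_le.1 fun hsf => hs.2 ⟨hs.1.1, le_min hs.1.2 hsf⟩)).symm

theorem isVickreyTime_const (hτ : 0 ≤ N.τ e) (hfint : Integrable f) (hf : ∀ t, 0 ≤ f t)
    (hf0 : ∀ t, t < 0 → f t = 0) (hf1 : ∀ s, N.tf < s → f s = 0)
    (hν : ∀ t, ENNReal.ofReal (f t) ≤ N.ν e) : N.IsVickreyTime e f fun _ => N.τ e := by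
  have houtflow : ∀ t, N.cumOutflow f (fun _ => N.τ e) t = ∫ s in Icc 0 (t - N.τ e), f s :=
    fun t => cumOutflow_eq_setIntegral hf1 (fun _ _ => hτ) fun s => le_sub_iff_add_le.symm
  have hqueue : ∀ t, N.queue e f (fun _ => N.τ e) t = 0 := fun t => by
    rw [queue, houtflow, add_sub_cancel_right, sub_self]
  refine ⟨fun t _ => by simp [hqueue], fun t _ => (hqueue t).ge, fun t => f (t - N.τ e),
    fun t => (hfint.comp_sub_right _).integrableOn,
    Filter.Eventually.of_forall fun t => ⟨hf _, hν _⟩, fun t _ => ?_⟩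
  rw [houtflow, ← setIntegral_Icc_eq_of_forall_neg_eq_zero hf0 (by linarith : 0 - N.τ e ≤ 0),
    ← integral_indicator measurableSet_Icc, ← integral_indicator measurableSet_Icc,
    ← integral_sub_right_eq_self _ (N.τ e)]
  congr 1
  ext s
  simp [indicator]

theorem isVickreyTime_of_outflow_indicator {p σ : ℝ → ℝ} {a b c : ℝ} (hτ : 0 ≤ N.τ e)
    (hν : N.ν e = ENNReal.ofReal c) (hc : 0 < c) (ha : 0 ≤ a) (hp : ∀ t, 0 ≤ p t)
    (hf : ∀ s, N.tf < s → f s = 0) (hσ : ∀ t s, s + (N.τ e + p s) ≤ t ↔ s ≤ σ t)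
    (hout : ∀ t, ∫ s in Icc 0 (σ t), f s = c * max 0 (min t b - a))
    (hin : ∀ t, ∫ s in Icc 0 t, f s = c * p t + c * max 0 (min (t + N.τ e) b - a)) :
    N.IsVickreyTime e f fun t => N.τ e + p t := by
  have houtflow : ∀ t, N.cumOutflow f (fun t => N.τ e + p t) t = c * max 0 (min t b - a) :=
    fun t => by rw [cumOutflow_eq_setIntegral hf (fun s _ => add_nonneg hτ (hp s)) (hσ t), hout]
  have hqueue : ∀ t, N.queue e f (fun t => N.τ e + p t) t = c * p t := fun t => by
    rw [queue, houtflow, hin, add_sub_cancel_right]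
  refine ⟨fun t _ => ?_, fun t _ => (hqueue t).symm ▸ mul_nonneg hc.le (hp t),
    (Icc a b).indicator fun _ => c, fun t => (integrable_indicator_Icc a b c).integrableOn,
    Filter.Eventually.of_forall fun t => ⟨indicator_nonneg (fun _ _ => hc.le) t, ?_⟩,
    fun t _ => by rw [houtflow, setIntegral_Icc_indicator c t ha]⟩
  · rw [hqueue, hν, ENNReal.toReal_inv, ENNReal.toReal_ofReal hc.le, mul_comm c,
      mul_inv_cancel_right₀ hc.ne']
  · rw [hν]
    exact ENNReal.ofReal_le_ofReal (indicator_le_self' (fun _ _ => hc.le) t)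

theorem mapsTo_arrival (hD : ∀ e, MapsTo (fun t => t + D e t) N.H N.H) (w : List E) (j : ℕ) :
    MapsTo (arrival D w j) N.H N.H := by
  unfold arrival
  induction w.take j with
  | nil => exact mapsTo_id _
  | cons e w ih => exact ih.comp (hD e)

open Classical in
theorem edgeMass_singleton (x e : E) (t : ℝ) :
    N.edgeMass D f [x] e t = if x = e then N.arrivedMass D f [x] 0 t else 0 :=
  Fin.sum_univ_one _

open Classical in
theorem edgeMass_three (x y z e : E) (t : ℝ) :
    N.edgeMass D f [x, y, z] e t =
      (if x = e then N.arrivedMass D f [x, y, z] 0 t else 0) +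
      (if y = e then N.arrivedMass D f [x, y, z] 1 t else 0) +
      (if z = e then N.arrivedMass D f [x, y, z] 2 t else 0) :=
  Fin.sum_univ_three _

open Classical in
theorem edgeMass_four (x y z u e : E) (t : ℝ) :
    N.edgeMass D f [x, y, z, u] e t =
      (if x = e then N.arrivedMass D f [x, y, z, u] 0 t else 0) +
      (if y = e then N.arrivedMass D f [x, y, z, u] 1 t else 0) +
      (if z = e then N.arrivedMass D f [x, y, z, u] 2 t else 0) +
      (if u = e then N.arrivedMass D f [x, y, z, u] 3 t else 0) :=
  Fin.sum_univ_four _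

theorem arrivedMass_indicator_of_affine {w : List E} {j : ℕ} {a b c α β : ℝ} (ha : 0 ≤ a)
    (hb : b ≤ N.tf) (hα : 0 < α) (h0 : 0 ≤ α * a + β)
    (harr : ∀ s ∈ Icc a b, arrival D w j s = α * s + β) (t : ℝ) :
    N.arrivedMass D ((Icc a b).indicator fun _ => c) w j t =
      c / α * max 0 (min t (α * b + β) - (α * a + β)) := by
  have hset : {s ∈ N.H | arrival D w j s ∈ Icc 0 t} ∩ Icc a b = Icc a (min ((t - β) / α) b) := by
    ext s
    constructor
    · rintro ⟨⟨-, hs⟩, hsab⟩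
      rw [harr s hsab] at hs
      refine ⟨hsab.1, le_min ((le_div_iff₀ hα).2 ?_) hsab.2⟩
      linarith [hs.2]
    · rintro ⟨has, hs⟩
      have hsb : s ≤ b := hs.trans (min_le_right _ _)
      have hst := (le_div_iff₀ hα).1 (hs.trans (min_le_left _ _))
      refine ⟨⟨⟨ha.trans has, hsb.trans hb⟩, ?_⟩, has, hsb⟩
      rw [harr s ⟨has, hsb⟩]
      have hαs := mul_le_mul_of_nonneg_left has hα.le
      exact ⟨by linarith, by linarith⟩
  have hmax : max 0 (min t (α * b + β) - (α * a + β)) =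
      α * max 0 (min ((t - β) / α) b - a) := by
    rw [mul_max_of_nonneg _ _ hα.le, mul_zero, mul_sub, mul_min_of_nonneg _ _ hα.le,
      mul_div_cancel₀ _ hα.ne', ← min_sub_sub_right, ← min_sub_sub_right]
    congr 2 <;> ring
  rw [arrivedMass, setIntegral_indicator measurableSet_Icc, hset, hmax, ← mul_assoc,
    div_mul_cancel₀ _ hα.ne']
  simp [mul_comm, max_comm]

theorem arrivedMass_indicator_zero {w : List E} {a b c : ℝ} (ha : 0 ≤ a) (hb : b ≤ N.tf) (t : ℝ) :
    N.arrivedMass D ((Icc a b).indicator fun _ => c) w 0 t = c * max 0 (min t b - a) := by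
  rw [arrivedMass_indicator_of_affine (α := 1) (β := 0) ha hb one_pos (by linarith)
    fun s _ => (by rw [one_mul, add_zero]; rfl)]
  simp only [one_mul, add_zero, div_one]

end Criterion

end VickreyNetwork

instance : DecidableEq FigComm := fun a b => by
  cases a <;> cases b <;> first | exact isTrue rfl | exact isFalse nofun

instance : Fintype FigComm where
  elems := {.c1, .c2, .c3, .c4, .c5}
  complete := fun x => by cases x <;> simp

open VickreyNetwork FigNode FigEdge FigComm

theorem FigComm.sum_univ {A : Type*} [AddCommMonoid A] (f : FigComm → A) :
    ∑ i, f i = f c1 + (f c2 + (f c3 + (f c4 + f c5))) := by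
  have huniv : (Finset.univ : Finset FigComm) = {.c1, .c2, .c3, .c4, .c5} := rfl
  simp [huniv]

theorem FigEdge.sum_univ {A : Type*} [AddCommMonoid A] (f : FigEdge → A) :
    ∑ e, f e = f e1 + (f e2 + (f e3 + (f e4 + (f e5 + (f e6 + f e7))))) := by
  have huniv : (Finset.univ : Finset FigEdge) = {.e1, .e2, .e3, .e4, .e5, .e6, .e7} := rfl
  simp [huniv]

namespace FigNet

variable {M ε tf' tf : ℝ} {g D : FigEdge → ℝ → ℝ}

local notation "𝒩" => figNetwork M ε tf' tf

section Walks

variable {w : List FigEdge} {v : FigNode}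

theorem exists_eq_cons_of_isWalk_d5 (hw : (𝒩).IsWalk d5 w v) (hv : d5 ≠ v) :
    (∃ w', w = e2 :: w' ∧ (𝒩).IsWalk s3d2 w' v) ∨ ∃ w', w = e6 :: w' ∧ (𝒩).IsWalk s2d1 w' v := by
  cases w with
  | nil => exact absurd hw hv
  | cons e w =>
    cases e <;> first
      | exact .inl ⟨w, rfl, hw.2⟩
      | exact .inr ⟨w, rfl, hw.2⟩
      | exact absurd hw.1 nofun

theorem exists_eq_cons_of_isWalk_s2d1 (hw : (𝒩).IsWalk s2d1 w v) (hv : s2d1 ≠ v) :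
    ∃ w', w = e5 :: w' ∧ (𝒩).IsWalk s5 w' v :=
  hw.exists_eq_cons hv fun e => by cases e <;> simp [figNetwork]

theorem exists_eq_cons_of_isWalk_s5 (hw : (𝒩).IsWalk s5 w v) (hv : s5 ≠ v) :
    ∃ w', w = e4 :: w' ∧ (𝒩).IsWalk d5 w' v :=
  hw.exists_eq_cons hv fun e => by cases e <;> simp [figNetwork]

theorem eq_nil_or_eq_singleton_of_isWalk_s3d2 (hw : (𝒩).IsWalk s3d2 w v) :
    w = [] ∧ v = s3d2 ∨ w = [e3] ∧ v = d3d4 := by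
  obtain rfl | ⟨w, rfl, hw'⟩ := hw.eq_nil_or_exists_eq_cons (e := e3)
    fun e => by cases e <;> simp [figNetwork]
  · exact .inl ⟨rfl, hw.symm⟩
  · obtain rfl := hw'.eq_nil fun e => by cases e <;> simp [figNetwork]
    exact .inr ⟨rfl, hw'.symm⟩

theorem e3_mem_of_isWalk (hw : (𝒩).IsWalk v w d3d4) (hv : v ≠ d3d4) : e3 ∈ w := by
  refine hw.mem_of_cut {d3d4}ᶜ (fun e' _ he' => ?_) hv (by simp)
  cases e' <;> simp [figNetwork] at he' ⊢

theorem e2_mem_of_isWalk {v' : FigNode} (hw : (𝒩).IsWalk v w v')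
    (hv : v ∉ ({s3d2, d3d4} : Set FigNode)) (hv' : v' ∈ ({s3d2, d3d4} : Set FigNode)) :
    e2 ∈ w := by
  refine hw.mem_of_cut {s3d2, d3d4}ᶜ (fun e' htail hhead => ?_) hv (not_not_intro hv')
  cases e' <;> simp [figNetwork] at htail hhead ⊢

theorem walk_c1 (w : (𝒩).Walk c1) : w.1 = [e7] ∨ ∃ w', w.1 = e7 :: e5 :: w' := by
  obtain ⟨w₁, hw, hw₁⟩ := w.2.exists_eq_cons (e := e7) nofun
    fun e => by cases e <;> simp [figNetwork]
  obtain rfl | ⟨w₂, rfl, -⟩ := hw₁.eq_nil_or_exists_eq_cons (e := e5)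
    fun e => by cases e <;> simp [figNetwork]
  exacts [.inl hw, .inr ⟨w₂, hw⟩]

theorem walk_c2 (w : (𝒩).Walk c2) :
    w.1 = [e5, e4, e2] ∨ ∃ w', w.1 = e5 :: e4 :: e6 :: e5 :: e4 :: w' := by
  obtain ⟨w₁, hw, hw₁⟩ := exists_eq_cons_of_isWalk_s2d1 w.2 nofun
  obtain ⟨w₂, rfl, hw₂⟩ := exists_eq_cons_of_isWalk_s5 hw₁ nofun
  obtain ⟨w₃, rfl, hw₃⟩ | ⟨w₃, rfl, hw₃⟩ := exists_eq_cons_of_isWalk_d5 hw₂ nofun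
  · obtain ⟨rfl, -⟩ | ⟨-, hv⟩ := eq_nil_or_eq_singleton_of_isWalk_s3d2 hw₃
    exacts [.inl hw, absurd hv nofun]
  · obtain ⟨w₄, rfl, hw₄⟩ := exists_eq_cons_of_isWalk_s2d1 hw₃ nofun
    obtain ⟨w₅, rfl, -⟩ := exists_eq_cons_of_isWalk_s5 hw₄ nofun
    exact .inr ⟨w₅, hw⟩

theorem walk_c3 (w : (𝒩).Walk c3) : w.1 = [e3] := by
  obtain ⟨-, hv⟩ | ⟨hw, -⟩ := eq_nil_or_eq_singleton_of_isWalk_s3d2 w.2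
  exacts [absurd hv nofun, hw]

theorem walk_c4 (w : (𝒩).Walk c4) :
    w.1 = [e1, e2, e3] ∨ ∃ w', w.1 = e1 :: e6 :: e5 :: e4 :: w' := by
  obtain ⟨w₁, hw, hw₁⟩ := w.2.exists_eq_cons (e := e1) nofun
    fun e => by cases e <;> simp [figNetwork]
  obtain ⟨w₂, rfl, hw₂⟩ | ⟨w₂, rfl, hw₂⟩ := exists_eq_cons_of_isWalk_d5 hw₁ nofun
  · obtain ⟨-, hv⟩ | ⟨rfl, -⟩ := eq_nil_or_eq_singleton_of_isWalk_s3d2 hw₂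
    exacts [absurd hv nofun, .inl hw]
  · obtain ⟨w₃, rfl, hw₃⟩ := exists_eq_cons_of_isWalk_s2d1 hw₂ nofun
    obtain ⟨w₄, rfl, -⟩ := exists_eq_cons_of_isWalk_s5 hw₃ nofun
    exact .inr ⟨w₄, hw⟩

theorem walk_c5 (w : (𝒩).Walk c5) : ∃ w', w.1 = e4 :: w' := by
  obtain ⟨w', hw, -⟩ := exists_eq_cons_of_isWalk_s5 w.2 nofun
  exact ⟨w', hw⟩

theorem walk_c2_prefix (w : (𝒩).Walk c2) : ∃ w', w.1 = e5 :: e4 :: w' := by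
  obtain hw | ⟨w', hw⟩ := walk_c2 w
  exacts [⟨_, hw⟩, ⟨_, hw⟩]

theorem walk_c4_prefix (w : (𝒩).Walk c4) : ∃ w', w.1 = e1 :: w' := by
  obtain hw | ⟨w', hw⟩ := walk_c4 w
  exacts [⟨_, hw⟩, ⟨_, hw⟩]

end Walks

section Crude

variable {h : (figNetwork M ε tf' tf).CWalk → ℝ → ℝ}

/-- A node potential witnessing that free flow travel times are at least `1 / 2` per edge up to a
bounded error, although the travel times of `e3` and `e4` may be arbitrarily small. -/
noncomputable def potential : FigNode → ℝ
  | .s5 => 1 / 2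
  | .s3d2 => 1 / 2
  | _ => 0

theorem potential_mem_Icc (v : FigNode) : potential v ∈ Icc (0 : ℝ) (1 / 2) := by
  cases v <;> norm_num [potential]

theorem half_add_potential_head_le (hε : ε ∈ Ioc 0 1) (e : FigEdge) :
    1 / 2 + potential ((𝒩).head e) ≤ (𝒩).τ e + potential ((𝒩).tail e) := by
  obtain ⟨hε0, hε1⟩ := hε
  cases e <;> simp only [figNetwork, potential] <;> linarith

theorem τ_mem_Icc (hε : ε ∈ Ioc 0 1) (e : FigEdge) : (𝒩).τ e ∈ Icc 0 4 := by
  obtain ⟨hε0, hε1⟩ := hε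
  cases e <;> simp only [figNetwork, mem_Icc] <;> constructor <;> linarith

theorem inv_ν_le_one (e : FigEdge) : ((𝒩).ν e)⁻¹.toReal ≤ 1 := by
  cases e <;> simp only [figNetwork] <;> norm_num

theorem inflow_le (i : FigComm) (s : ℝ) : (𝒩).inflow i s ≤ 6 := by
  cases i <;> simp only [figNetwork, indicator] <;> split_ifs <;> norm_num

theorem integrableOn_inflow (i : FigComm) {S : Set ℝ} (hS : volume S ≠ ⊤) :
    IntegrableOn ((𝒩).inflow i) S := by
  cases i <;> exact (integrableOn_const hS).indicator measurableSet_Icc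

theorem volume_H_ne_top : volume (𝒩).H ≠ ⊤ := measure_Icc_lt_top.ne

theorem lt_arrival_of_le (hε : ε ∈ Ioc 0 1) (htf : tf' ≤ tf) (hD : (𝒩).IsTraversalTime g D)
    {i : FigComm} (w : (𝒩).Walk i) {n k : ℕ} (hn : (n : ℝ) ≤ tf') (hk : k ≤ w.1.length)
    (hnk : 2 * n + 2 ≤ k) {s : ℝ} (hs : s ∈ (𝒩).H) : n < arrival D w.1 k s := by
  by_contra! hle
  have hpot := hD.add_mul_le_arrival htf w (fun v => (potential_mem_Icc v).1)
    (half_add_potential_head_le hε) hk hs (hle.trans hn)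
  have hnk' : (2 * n + 2 : ℝ) ≤ k := mod_cast hnk
  linarith [hs.1, (potential_mem_Icc ((𝒩).source i)).2]

theorem sum_setIntegral_inflow_le {t : ℝ} (ht : 0 ≤ t) :
    ∑ i, ∫ s in Icc 0 t, (𝒩).inflow i s ≤ 30 * t := by
  have hcomm : ∀ i, ∫ s in Icc 0 t, (𝒩).inflow i s ≤ 6 * t := fun i =>
    calc ∫ s in Icc 0 t, (𝒩).inflow i s
        ≤ ∫ _ in Icc 0 t, (6 : ℝ) :=
          setIntegral_mono (integrableOn_inflow i (by simp)) (by simp) (inflow_le i)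
      _ = 6 * t := by simp [ht, mul_comm]
  rw [FigComm.sum_univ]
  linarith [hcomm c1, hcomm c2, hcomm c3, hcomm c4, hcomm c5]

theorem setIntegral_edge_le (hε : ε ∈ Ioc 0 1) (htf : tf' ≤ tf) (hI : (𝒩).Induces h g D)
    (e : FigEdge) {n : ℕ} (hn : (n : ℝ) ≤ tf') :
    ∫ s in Icc 0 (n : ℝ), g e s ≤ (2 * n + 2) * (30 * n) := by
  have hnH : (n : ℝ) ∈ (𝒩).H := ⟨n.cast_nonneg, hn.trans htf⟩
  calc ∫ s in Icc 0 (n : ℝ), g e s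
      = ∑ i, (𝒩).commodityMass h D i e n := (hI.sum_commodityMass e hnH).symm
    _ ≤ ∑ i, ((2 * n + 2 : ℕ) : ℝ) * ∫ s in Icc 0 (n : ℝ), (𝒩).inflow i s := by
        refine Finset.sum_le_sum fun i _ => hI.commodityMass_le hnH
          ((hI.hasSum_setIntegral i (integrableOn_inflow i volume_H_ne_top)
            (Icc_subset_Icc_right hnH.2)).mul_left _) fun w => ?_
        exact hI.traversal.edgeMass_le (hI.isRate_walk _) w hnH.2 fun k hk hnk s hs =>
          lt_arrival_of_le hε htf hI.traversal w hn hk hnk hs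
    _ ≤ (2 * n + 2) * (30 * n) := by
        rw [← Finset.mul_sum]
        push_cast
        gcongr
        exact sum_setIntegral_inflow_le n.cast_nonneg

/-- A crude bound on the exit time of an edge that is entered by time `n`: the free flow travel
time plus the largest possible volume of the queue. -/
def exitBound (n : ℕ) : ℕ := n + 4 + (2 * n + 2) * (30 * n)

theorem le_exitBound (n : ℕ) : n ≤ exitBound n := by
  unfold exitBound
  omega

theorem exit_le_exitBound (hε : ε ∈ Ioc 0 1) (htf : tf' ≤ tf) (hI : (𝒩).Induces h g D)
    (e : FigEdge) {n : ℕ} (hn : (n : ℝ) ≤ tf') {t : ℝ} (ht : t ∈ Icc 0 (n : ℝ)) :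
    t + D e t ≤ exitBound n := by
  obtain ⟨d, hd, hDd⟩ := hI.traversal.vickrey e
  have htH : t ∈ (𝒩).H := ⟨ht.1, ht.2.trans (hn.trans htf)⟩
  have hτ : (𝒩).τ e ∈ Icc 0 4 := τ_mem_Icc hε e
  have hν : ((𝒩).ν e)⁻¹.toReal ≤ 1 := inv_ν_le_one e
  have hqueue : (𝒩).queue e (g e) d t ≤ (2 * n + 2) * (30 * n) :=
    (hd.queue_le hτ.1 ht.1).trans (((hI.isRate_edge e).setIntegral_mono_set
      (Icc_subset_Icc_right ht.2) (Icc_subset_Icc_right (hn.trans htf))).trans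
      (setIntegral_edge_le hε htf hI e hn))
  have hdelay := mul_le_of_le_one_right (hd.queue_nonneg t htH) hν
  rw [hDd ⟨ht.1, ht.2.trans hn⟩, hd.time_eq t htH]
  unfold exitBound
  push_cast
  linarith [hτ.2, ht.2]

theorem arrival_le_iterate_exitBound (hε : ε ∈ Ioc 0 1) (htf : tf' ≤ tf)
    (hI : (𝒩).Induces h g D) {i : FigComm} (w : (𝒩).Walk i) {n j : ℕ}
    (hn : (exitBound^[j] n : ℝ) ≤ tf') (hj : j ≤ w.1.length) {s : ℝ} (hs : s ∈ Icc 0 (n : ℝ)) :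
    arrival D w.1 j s ≤ exitBound^[j] n := by
  induction j with
  | zero => exact hs.2
  | succ j ih =>
    have hle : (exitBound^[j] n : ℝ) ≤ exitBound^[j + 1] n := by
      exact_mod_cast Function.monotone_iterate_of_id_le le_exitBound (Nat.le_succ j) n
    have hsn : (n : ℝ) ≤ exitBound^[j] n :=
      mod_cast Function.monotone_iterate_of_id_le le_exitBound (Nat.zero_le j) n
    have hsH : s ∈ (𝒩).H := ⟨hs.1, by
      change s ≤ tf
      linarith [hs.2]⟩
    rw [arrival_succ D w.1 (by omega)]
    rw [Function.iterate_succ_apply'] at hn hle ⊢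
    exact exit_le_exitBound hε htf hI _ (hle.trans hn)
      ⟨(hI.traversal.mapsTo i w j (by omega) hsH).1, ih (hle.trans hn) (by omega)⟩

end Crude

section Direct

variable {h : (figNetwork M ε tf' tf).CWalk → ℝ → ℝ} {i : FigComm} {e : FigEdge} {a b c : ℝ}

/-- The only walk of the second commodity without cycles. -/
def walkC2 : (𝒩).Walk c2 := ⟨[e5, e4, e2], rfl, rfl, rfl, rfl⟩

/-- The only walk of the fourth commodity without cycles. -/
def walkC4 : (𝒩).Walk c4 := ⟨[e1, e2, e3], rfl, rfl, rfl, rfl⟩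

/-- A time, independent of `M` and `ε`, by which all particles of the second and fourth commodity
have traversed their first four edges. -/
def clearTime : ℕ := exitBound^[4] 5

theorem iterate_exitBound_le_clearTime {j : ℕ} (hj : j ≤ 4) :
    (exitBound^[j] 5 : ℝ) ≤ clearTime :=
  mod_cast Function.monotone_iterate_of_id_le le_exitBound hj 5

theorem thirty_le_clearTime : (30 : ℝ) ≤ clearTime := by
  have hone : 30 ≤ exitBound^[1] 5 := by norm_num [exitBound]
  exact (Nat.cast_le.2 hone).trans (iterate_exitBound_le_clearTime (by norm_num))

theorem ae_mem_Ioo_of_ne_zero (hI : (𝒩).Induces h g D)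
    (hr : (𝒩).inflow i = (Icc a b).indicator fun _ => c) (w : (𝒩).Walk i) :
    ∀ᵐ s ∂(volume.restrict (𝒩).H), h ⟨i, w⟩ s ≠ 0 → s ∈ Ioo a b := by
  refine hI.ae_mem_of_ne_zero ?_ w
  have ha : ∀ᵐ s : ℝ, s ≠ a := compl_mem_ae_iff.2 (measure_singleton a)
  have hb : ∀ᵐ s : ℝ, s ≠ b := compl_mem_ae_iff.2 (measure_singleton b)
  filter_upwards [ae_restrict_of_ae ha, ae_restrict_of_ae hb] with s hsa hsb hs
  rw [hr]
  exact indicator_of_notMem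
    (fun hs' => hs ⟨hs'.1.lt_of_ne hsa.symm, hs'.2.lt_of_ne hsb⟩) _

/-- The total network inflow of each commodity. -/
def demand (M : ℝ) : FigComm → ℝ
  | .c1 => 6
  | .c2 => 2
  | .c3 => 3 + M
  | .c4 => 1
  | .c5 => 2 * (4 + M)

/-- The walk flow `h` induces the edge flow `g` and sends the first commodity directly along `e7`,
so that it does not run through the cycle `e5, e4, e6`; the horizons and `M` are large. -/
structure IsDirect (h : (figNetwork M ε tf' tf).CWalk → ℝ → ℝ) (g D : FigEdge → ℝ → ℝ) :
    Prop where
  ε_mem : ε ∈ Ioc 0 1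
  le_tf' : 13 + M ≤ tf'
  tf'_le : tf' ≤ tf
  clearTime_le : clearTime ≤ 10 + M
  induces : (figNetwork M ε tf' tf).Induces h g D
  direct : ∀ w : (figNetwork M ε tf' tf).Walk c1, w.1 ≠ [e7] →
    ∀ᵐ s ∂(volume.restrict (figNetwork M ε tf' tf).H), h ⟨c1, w⟩ s = 0

namespace IsDirect

theorem twenty_le (hd : IsDirect h g D) : 20 ≤ M := by
  linarith [hd.clearTime_le, thirty_le_clearTime]

theorem mem_H (hd : IsDirect h g D) {t : ℝ} (h0 : 0 ≤ t) (ht : t ≤ 13 + M) : t ∈ (𝒩).H :=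
  ⟨h0, ht.trans (hd.le_tf'.trans hd.tf'_le)⟩

theorem mem_H' (hd : IsDirect h g D) {t : ℝ} (h0 : 0 ≤ t) (ht : t ≤ 13 + M) : t ∈ (𝒩).H' :=
  ⟨h0, ht.trans hd.le_tf'⟩

theorem Icc_subset_H (hd : IsDirect h g D) {t : ℝ} (ht : t ≤ 13 + M) : Icc 0 t ⊆ (𝒩).H :=
  Icc_subset_Icc_right (ht.trans (hd.le_tf'.trans hd.tf'_le))

theorem ae_mem_Ioo (hd : IsDirect h g D)
    (hr : (𝒩).inflow i = (Icc a b).indicator fun _ => c) (w : (𝒩).Walk i) :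
    ∀ᵐ s ∂(volume.restrict (𝒩).H), h ⟨i, w⟩ s ≠ 0 → s ∈ Ioo a b :=
  ae_mem_Ioo_of_ne_zero hd.induces hr w

theorem arrival_le (hd : IsDirect h g D) (w : (𝒩).Walk i) {j : ℕ} (hj4 : j ≤ 4)
    (hj : j ≤ w.1.length) {s : ℝ} (hs : s ∈ Icc 0 5) : arrival D w.1 j s ≤ clearTime := by
  have hle := iterate_exitBound_le_clearTime hj4
  exact (arrival_le_iterate_exitBound hd.ε_mem hd.tf'_le hd.induces w (n := 5)
    (by linarith [hd.clearTime_le, hd.le_tf']) hj (by simpa using hs)).trans hle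

theorem arrival_add_τ_le (hd : IsDirect h g D) (w : (𝒩).Walk i) {j k : ℕ} (hj4 : j ≤ 4)
    (hjk : j < k) (hk : k ≤ w.1.length) (he : w.1[j] = e) {s : ℝ} (hs : s ∈ Icc 0 5) :
    arrival D w.1 j s + (𝒩).τ e ≤ arrival D w.1 k s := by
  have hD := hd.induces.traversal
  have hsH : s ∈ (𝒩).H := hd.mem_H hs.1 (by linarith [hs.2, hd.twenty_le])
  have hclear := hd.arrival_le w hj4 (by omega) hs
  have hτ := hD.τ_le hd.tf'_le e
    (hd.mem_H' (hD.mapsTo i w j (by omega) hsH).1 (by linarith [hd.clearTime_le]))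
  have hsucc := hD.arrival_le_arrival w hjk hk hsH
  rw [arrival_succ D w.1 (by omega), he] at hsucc
  linarith

theorem commodityMass_eq_zero_of_le (hd : IsDirect h g D)
    (hr : (𝒩).inflow i = (Icc a b).indicator fun _ => c) {t : ℝ} (ht : t ≤ a) :
    (𝒩).commodityMass h D i e t = 0 := by
  refine hd.induces.commodityMass_eq_zero fun w k hk _ => ?_
  filter_upwards [hd.ae_mem_Ioo hr w, ae_restrict_mem measurableSet_H] with s hs hsH hne
  exact (ht.trans_lt (hs hne).1).trans_le (hd.induces.traversal.le_arrival w hk.le hsH)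

theorem commodityMass_c1 (hd : IsDirect h g D) (he : e ≠ e7) (t : ℝ) :
    (𝒩).commodityMass h D c1 e t = 0 := by
  refine hd.induces.commodityMass_eq_zero fun w k hk hke => ?_
  have hw : w.1 ≠ [e7] := by
    intro hw
    have hmem : e ∈ w.1 := hke ▸ List.getElem_mem hk
    simp only [hw, List.mem_singleton] at hmem
    exact he hmem
  filter_upwards [hd.direct w hw] with s hs hne using absurd hs hne

theorem commodityMass_c2_e5 (hd : IsDirect h g D) {t : ℝ} (ht : t ≤ 3) :
    (𝒩).commodityMass h D c2 e5 t = ∫ s in Icc 0 t, (𝒩).inflow c2 s := by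
  have hε := hd.ε_mem
  have hM := hd.twenty_le
  rw [hd.induces.commodityMass_eq_setIntegral (integrableOn_inflow c2 volume_H_ne_top)
    (j := 0) (δ := 0), sub_zero]
  · change t - 0 ≤ tf
    linarith [hd.le_tf', hd.tf'_le]
  · intro w
    obtain ⟨w', hw⟩ := walk_c2_prefix w
    simp [hw]
  · exact fun w => .of_forall fun s _ => (add_zero s).symm
  · intro w k hk hk0 _
    obtain ⟨w', hw⟩ := walk_c2_prefix w
    filter_upwards [hd.ae_mem_Ioo (a := 2) (b := 3) rfl w] with s hs hne
    have hexit : s + (2 - ε) ≤ arrival D w.1 k s :=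
      hd.arrival_add_τ_le w (j := 0) (e := e5) (by norm_num) (by omega) hk.le (by simp [hw])
        ⟨by linarith [(hs hne).1], by linarith [(hs hne).2]⟩
    linarith [(hs hne).1, hε.2]

theorem setIntegral_e5 (hd : IsDirect h g D) {t : ℝ} (ht : t ∈ Icc 0 3) :
    ∫ s in Icc 0 t, g e5 s = ∫ s in Icc 0 t, (𝒩).inflow c2 s := by
  obtain ⟨ht0, ht3⟩ := ht
  have hM := hd.twenty_le
  rw [← hd.induces.sum_commodityMass e5 (hd.mem_H ht0 (by linarith)), FigComm.sum_univ,
    hd.commodityMass_c1 (by decide), hd.commodityMass_c2_e5 ht3,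
    hd.commodityMass_eq_zero_of_le (i := c3) rfl (by linarith),
    hd.commodityMass_eq_zero_of_le (i := c4) rfl (by linarith),
    hd.commodityMass_eq_zero_of_le (i := c5) rfl (by linarith)]
  simp only [zero_add, add_zero]

theorem time_e5 (hd : IsDirect h g D) {t : ℝ} (ht : t ∈ Icc 0 3) : D e5 t = 2 - ε := by
  refine hd.induces.traversal.time_eq_τ hd.tf'_le (hd.induces.isRate_edge e5) (c := 2) (b := 3)
    (by simp [figNetwork]) two_pos (τ_mem_Icc hd.ε_mem e5).1
    (by linarith [hd.le_tf', hd.twenty_le] : 3 ≤ tf') (fun s t hs hst ht => ?_) ht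
  rw [hd.setIntegral_e5 ⟨hs.trans hst, ht⟩, hd.setIntegral_e5 ⟨hs, hst.trans ht⟩]
  exact setIntegral_Icc_indicator_sub_le (by norm_num) (by norm_num) hst

theorem arrival_one_c2 (hd : IsDirect h g D) (w : (𝒩).Walk c2) {s : ℝ} (hs : s ∈ Icc 0 3) :
    arrival D w.1 1 s = s + (2 - ε) := by
  obtain ⟨w', hw⟩ := walk_c2_prefix w
  rw [hw, ← hd.time_e5 hs]
  rfl

theorem commodityMass_c2_e4 (hd : IsDirect h g D) {t : ℝ} (ht : t ≤ 5 - ε) :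
    (𝒩).commodityMass h D c2 e4 t = ∫ s in Icc 0 (t - (2 - ε)), (𝒩).inflow c2 s := by
  obtain ⟨hε0, _⟩ := hd.ε_mem
  have hM := hd.twenty_le
  refine hd.induces.commodityMass_eq_setIntegral (integrableOn_inflow c2 volume_H_ne_top)
    (j := 1) ?_ ?_ ?_ ?_
  · change t - (2 - ε) ≤ tf
    linarith [hd.le_tf', hd.tf'_le]
  · intro w
    obtain ⟨w', hw⟩ := walk_c2_prefix w
    simp [hw]
  · intro w
    filter_upwards [hd.ae_mem_Ioo (a := 2) (b := 3) rfl w] with s hs hne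
    exact hd.arrival_one_c2 w ⟨by linarith [(hs hne).1], (hs hne).2.le⟩
  · intro w k hk hk1 hke
    filter_upwards [hd.ae_mem_Ioo (a := 2) (b := 3) rfl w] with s hs hne
    obtain ⟨hs2, hs3⟩ := hs hne
    obtain hw | ⟨w', hw⟩ := walk_c2 w
    · simp only [hw] at hk hke
      simp only [List.length_cons, List.length_nil] at hk
      interval_cases k <;> simp at hk1 hke
    · have hk3 : 2 < k := by
        simp only [hw] at hke
        by_contra! hk3
        interval_cases k <;> simp at hk1 hke
      have hcycle : arrival D w.1 2 s + 4 ≤ arrival D w.1 k s :=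
        hd.arrival_add_τ_le w (e := e6) (by norm_num) hk3 hk.le (by simp [hw])
          ⟨by linarith, by linarith⟩
      have := hd.induces.traversal.le_arrival w (hk3.le.trans hk.le)
        (hd.mem_H (t := s) (by linarith) (by linarith))
      linarith

theorem commodityMass_c4_eq_zero (hd : IsDirect h g D) (he : e ≠ e1) {t : ℝ} (ht : t ≤ 5) :
    (𝒩).commodityMass h D c4 e t = 0 := by
  have := hd.twenty_le
  refine hd.induces.commodityMass_eq_zero fun w k hk hke => ?_
  obtain ⟨w', hw⟩ := walk_c4_prefix w
  have hk0 : 0 < k := by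
    refine Nat.pos_of_ne_zero ?_
    rintro rfl
    simp only [hw, List.getElem_cons_zero] at hke
    exact he hke.symm
  filter_upwards [hd.ae_mem_Ioo (a := 4) (b := 5) rfl w] with s hs hne
  obtain ⟨hs4, hs5⟩ := hs hne
  have hexit : s + 1 ≤ arrival D w.1 k s :=
    hd.arrival_add_τ_le w (e := e1) (by norm_num) hk0 hk.le (by simp [hw])
      ⟨by linarith, hs5.le⟩
  linarith

theorem setIntegral_e4 (hd : IsDirect h g D) {t : ℝ} (ht : t ∈ Icc 0 (5 - ε)) :
    ∫ s in Icc 0 t, g e4 s = ∫ s in Icc 0 (t - (2 - ε)), (𝒩).inflow c2 s := by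
  obtain ⟨ht0, ht5⟩ := ht
  have hε := hd.ε_mem.1
  have hM := hd.twenty_le
  rw [← hd.induces.sum_commodityMass e4 (hd.mem_H ht0 (by linarith)), FigComm.sum_univ,
    hd.commodityMass_c1 (by decide), hd.commodityMass_c2_e4 ht5,
    hd.commodityMass_eq_zero_of_le (i := c3) rfl (by linarith),
    hd.commodityMass_c4_eq_zero (by decide) (by linarith),
    hd.commodityMass_eq_zero_of_le (i := c5) rfl (by linarith)]
  simp only [zero_add, add_zero]

theorem time_e4 (hd : IsDirect h g D) {t : ℝ} (ht : t ∈ Icc 0 (5 - ε)) : D e4 t = ε := by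
  have hε := hd.ε_mem.1
  refine hd.induces.traversal.time_eq_τ hd.tf'_le (hd.induces.isRate_edge e4) (c := 2)
    (b := 5 - ε) (by simp [figNetwork]) two_pos hε.le
    (by linarith [hd.le_tf', hd.twenty_le] : 5 - ε ≤ tf') (fun s t hs hst ht => ?_) ht
  rw [hd.setIntegral_e4 ⟨hs.trans hst, ht⟩, hd.setIntegral_e4 ⟨hs, hst.trans ht⟩]
  have hle := setIntegral_Icc_indicator_sub_le (a := 2) (b := 3) (c := 2) (by norm_num)
    (by norm_num) (sub_le_sub_right hst (2 - ε))
  rwa [sub_sub_sub_cancel_right] at hle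

theorem arrival_two_c2 (hd : IsDirect h g D) (w : (𝒩).Walk c2) {s : ℝ} (hs : s ∈ Icc 0 3) :
    arrival D w.1 2 s = s + 2 := by
  obtain ⟨hs0, hs3⟩ := hs
  obtain ⟨w', hw⟩ := walk_c2_prefix w
  rw [arrival_succ D w.1 (by simp [hw]), hd.arrival_one_c2 w ⟨hs0, hs3⟩]
  simp only [hw, List.getElem_cons_succ, List.getElem_cons_zero]
  rw [hd.time_e4 ⟨by linarith [hd.ε_mem.2], by linarith⟩]
  ring

theorem setIntegral_H_inflow (hd : IsDirect h g D) (i : FigComm) :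
    ∫ s in (𝒩).H, (𝒩).inflow i s = demand M i := by
  have hM := hd.twenty_le
  have hbound : 13 + M ≤ tf := hd.le_tf'.trans hd.tf'_le
  have hind : ∀ {a b c : ℝ}, 0 ≤ a → a ≤ b → b ≤ tf →
      ∫ s in (𝒩).H, (Icc a b).indicator (fun _ => c) s = c * (b - a) := by
    intro a b c ha hab hb
    rw [show (𝒩).H = Icc 0 tf from rfl, setIntegral_Icc_indicator c tf ha, min_eq_right hb,
      max_eq_right (sub_nonneg.2 hab)]
  cases i <;> refine (hind ?_ ?_ ?_).trans ?_ <;>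
    first | linarith | (simp only [demand]; ring)

theorem walkMass_le_demand (hd : IsDirect h g D) (w : (𝒩).Walk i) :
    (𝒩).walkMass h ⟨i, w⟩ ≤ demand M i :=
  hd.setIntegral_H_inflow i ▸ hd.induces.walkMass_le (integrableOn_inflow i volume_H_ne_top) w

theorem mul_sub_le_commodityMass_sub (hd : IsDirect h g D)
    (hr : (𝒩).inflow i = (Icc a b).indicator fun _ => c)
    (hhead : ∀ w : (𝒩).Walk i, ∃ w', w.1 = e :: w') (ha : 0 ≤ a) (hb : b ≤ 13 + M)
    {t₁ t₂ : ℝ} (hat : a ≤ t₁) (ht : t₁ ≤ t₂) (htb : t₂ ≤ b) :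
    c * (t₂ - t₁) ≤ (𝒩).commodityMass h D i e t₂ - (𝒩).commodityMass h D i e t₁ := by
  refine le_of_eq_of_le ?_ (hd.induces.setIntegral_inflow_sub_le_commodityMass_sub
    (integrableOn_inflow i volume_H_ne_top) hhead (hd.mem_H (by linarith) (by linarith))
    (hd.mem_H (by linarith) (by linarith)) ht)
  rw [hr, setIntegral_Icc_indicator c t₂ ha, setIntegral_Icc_indicator c t₁ ha,
    min_eq_left htb, min_eq_left (ht.trans htb), max_eq_right (sub_nonneg.2 hat),
    max_eq_right (sub_nonneg.2 (hat.trans ht))]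
  ring

theorem walkMass_walkC2_le_commodityMass_sub (hd : IsDirect h g D) {t : ℝ} (ht : 5 ≤ t)
    (htM : t ≤ 13 + M) : (𝒩).walkMass h ⟨c2, walkC2⟩ ≤
      (𝒩).commodityMass h D c2 e2 t - (𝒩).commodityMass h D c2 e2 4 := by
  refine (hd.induces.walkMass_le_edgeMass_sub walkC2 (j := 2) (by simp [walkC2])
    (by simp [walkC2]) (by linarith) ?_).trans (hd.induces.edgeMass_sub_le_commodityMass_sub
      walkC2 (hd.mem_H (by norm_num) (by linarith)) (hd.mem_H (by linarith) htM) (by linarith))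
  filter_upwards [hd.ae_mem_Ioo (a := 2) (b := 3) rfl walkC2] with s hs hne
  obtain ⟨hs2, hs3⟩ := hs hne
  rw [hd.arrival_two_c2 walkC2 ⟨by linarith, hs3.le⟩]
  exact ⟨by linarith, by linarith⟩

theorem setIntegral_walkC4_le_commodityMass_sub (hd : IsDirect h g D) {s : ℝ}
    (hs : s ∈ Icc 4 5) : ∫ u in Icc 0 s, h ⟨c4, walkC4⟩ u ≤
      (𝒩).commodityMass h D c4 e2 (s + D e1 s) - (𝒩).commodityMass h D c4 e2 4 := by
  obtain ⟨hs4, hs5⟩ := hs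
  have hM := hd.twenty_le
  have hD := hd.induces.traversal
  have hexit : s + 1 ≤ s + D e1 s :=
    add_le_add_right (hD.τ_le hd.tf'_le e1 (hd.mem_H' (by linarith) (by linarith))) s
  have hclear : s + D e1 s ≤ clearTime :=
    hd.arrival_le walkC4 (j := 1) (by norm_num) (by simp [walkC4]) ⟨by linarith, hs5⟩
  have hclearM := hd.clearTime_le
  have hlt : 1 < [e1, e2, e3].length := by simp
  have harrived : ∫ u in Icc 0 s, h ⟨c4, walkC4⟩ u ≤
      (𝒩).arrivedMass D (h ⟨c4, walkC4⟩) [e1, e2, e3] 1 (s + D e1 s) :=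
    (hd.induces.isRate_walk _).setIntegral_mono_set
      (fun u hu => have huH := hd.Icc_subset_H (by linarith : s ≤ 13 + M) hu
        ⟨huH, (hD.mapsTo c4 walkC4 1 hlt.le huH).1,
          hD.fifo e1 huH (hd.mem_H (by linarith) (by linarith)) hu.2⟩) (sep_subset _ _)
  have hzero : (𝒩).arrivedMass D (h ⟨c4, walkC4⟩) [e1, e2, e3] 1 4 = 0 := by
    refine hD.arrivedMass_eq_zero walkC4 hlt.le ?_
    filter_upwards [hd.ae_mem_Ioo (a := 4) (b := 5) rfl walkC4, ae_restrict_mem measurableSet_H]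
      with u hu huH hne
    exact (hu hne).1.trans_le (hD.le_arrival walkC4 hlt.le huH)
  have hedge := (hd.induces.isRate_walk ⟨c4, walkC4⟩).arrivedMass_sub_le_edgeMass_sub (D := D)
    (e := e2) hlt rfl (by linarith : 4 ≤ s + D e1 s)
  have hcomm := hedge.trans (hd.induces.edgeMass_sub_le_commodityMass_sub walkC4
    (hd.mem_H (by norm_num) (by linarith)) (hd.mem_H (by linarith) (by linarith)) (by linarith))
  linarith

theorem le_arrival_two_walkC4 (hd : IsDirect h g D) {s : ℝ} (hs : s ∈ Icc 4 5) :
    5 + (𝒩).walkMass h ⟨c2, walkC2⟩ + ∫ u in Icc 0 s, h ⟨c4, walkC4⟩ u ≤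
      arrival D [e1, e2, e3] 2 s := by
  obtain ⟨hs4, hs5⟩ := hs
  have hM := hd.twenty_le
  have hclearM := hd.clearTime_le
  have hexit : s + 1 ≤ s + D e1 s :=
    add_le_add_right (hd.induces.traversal.τ_le hd.tf'_le e1
      (hd.mem_H' (by linarith) (by linarith))) s
  have hclear : s + D e1 s ≤ clearTime :=
    hd.arrival_le walkC4 (j := 1) (by norm_num) (by simp [walkC4]) ⟨by linarith, hs5⟩
  have htime := hd.induces.traversal.le_time hd.tf'_le (e := e2) (c := 1) (s := 4)
    (t := s + D e1 s) (by simp [figNetwork]) one_pos (τ_mem_Icc hd.ε_mem e2).1 (by norm_num)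
    (by linarith) ((by linarith : s + D e1 s ≤ 13 + M).trans hd.le_tf')
  have hsum := hd.induces.sum_commodityMass_sub_le e2 {c2, c4}
    (hd.mem_H (t := 4) (by norm_num) (by linarith))
    (hd.mem_H (t := s + D e1 s) (by linarith) (by linarith)) (by linarith)
  rw [Finset.sum_pair (by decide)] at hsum
  have hc2 := hd.walkMass_walkC2_le_commodityMass_sub (t := s + D e1 s) (by linarith)
    (by linarith)
  have hc4 := hd.setIntegral_walkC4_le_commodityMass_sub ⟨hs4, hs5⟩
  have hτ : (𝒩).τ e2 = 1 := rfl
  change _ ≤ s + D e1 s + D e2 (s + D e1 s)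
  linarith

theorem arrivedMass_walkC4_le (hd : IsDirect h g D) :
    (𝒩).arrivedMass D (h ⟨c4, walkC4⟩) [e1, e2, e3] 2 7 ≤
      2 - (𝒩).walkMass h ⟨c2, walkC2⟩ := by
  have hM := hd.twenty_le
  have hD := hd.induces.traversal
  have hrate := hd.induces.isRate_walk ⟨c4, walkC4⟩
  have hH : Icc 4 5 ⊆ (𝒩).H :=
    (Icc_subset_Icc_left (by norm_num)).trans (hd.Icc_subset_H (by linarith))
  have hlt : 2 < [e1, e2, e3].length := by simp
  set A : Set ℝ := Icc 4 5 ∩ arrival D [e1, e2, e3] 2 ⁻¹' Iic 7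
  have hA : IsClosed A :=
    ((hD.continuousOn_arrival walkC4 hlt.le).mono hH).preimage_isClosed_of_isClosed
      isClosed_Icc isClosed_Iic
  have hmass : (𝒩).arrivedMass D (h ⟨c4, walkC4⟩) [e1, e2, e3] 2 7 =
      ∫ s in A, h ⟨c4, walkC4⟩ s := by
    refine hD.arrivedMass_eq walkC4 hlt.le hA.measurableSet (inter_subset_left.trans hH) ?_
    filter_upwards [hd.ae_mem_Ioo (a := 4) (b := 5) rfl walkC4] with s hs hne
    exact (and_iff_right (Ioo_subset_Icc_self (hs hne))).symm
  rw [hmass]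
  obtain hempty | hne := A.eq_empty_or_nonempty
  · rw [hempty, setIntegral_empty]
    exact sub_nonneg.2 (hd.walkMass_le_demand walkC2)
  · obtain ⟨σ, ⟨hσ, hσ7⟩, hmax⟩ :=
      (isCompact_Icc.of_isClosed_subset hA inter_subset_left).exists_isGreatest hne
    have hle := hrate.setIntegral_mono_set (A := A) (B := Icc 0 σ)
      (fun s hs => ⟨(by norm_num : (0 : ℝ) ≤ 4).trans hs.1.1, hmax hs⟩)
      (hd.Icc_subset_H (by linarith [hσ.2]))
    have harr := (hd.le_arrival_two_walkC4 hσ).trans hσ7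
    linarith

theorem walkMass_walkC4_le_commodityMass_sub (hd : IsDirect h g D) {t : ℝ}
    (ht : t ∈ Icc (clearTime : ℝ) (10 + M)) :
    (𝒩).walkMass h ⟨c4, walkC4⟩ + (𝒩).walkMass h ⟨c2, walkC2⟩ - 2 ≤
      (𝒩).commodityMass h D c4 e3 t - (𝒩).commodityMass h D c4 e3 7 := by
  obtain ⟨htK, htM⟩ := ht
  have hK := thirty_le_clearTime
  have hlt : 2 < [e1, e2, e3].length := by simp
  have hall : (𝒩).arrivedMass D (h ⟨c4, walkC4⟩) [e1, e2, e3] 2 t =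
      (𝒩).walkMass h ⟨c4, walkC4⟩ := by
    refine hd.induces.traversal.arrivedMass_eq_mass walkC4 hlt.le ?_
    filter_upwards [hd.ae_mem_Ioo (a := 4) (b := 5) rfl walkC4] with s hs hne
    exact (hd.arrival_le walkC4 (by norm_num) hlt.le
      ⟨by linarith [(hs hne).1], (hs hne).2.le⟩).trans htK
  have hedge := (hd.induces.isRate_walk ⟨c4, walkC4⟩).arrivedMass_sub_le_edgeMass_sub (D := D)
    (e := e3) hlt rfl (by linarith : 7 ≤ t)
  have hcomm := hedge.trans (hd.induces.edgeMass_sub_le_commodityMass_sub walkC4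
    (hd.mem_H (by norm_num) (by linarith)) (hd.mem_H (by linarith) (by linarith)) (by linarith))
  have hearly := hd.arrivedMass_walkC4_le
  linarith

theorem le_setIntegral_e3_sub (hd : IsDirect h g D) {t : ℝ}
    (ht : t ∈ Icc (clearTime : ℝ) (10 + M)) :
    (𝒩).walkMass h ⟨c4, walkC4⟩ + (𝒩).walkMass h ⟨c2, walkC2⟩ - 2 + (t - 7) ≤
      (∫ s in Icc 0 t, g e3 s) - ∫ s in Icc 0 7, g e3 s := by
  have hK := thirty_le_clearTime
  have h7t : 7 ≤ t := by linarith [ht.1]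
  have hc3 := hd.mul_sub_le_commodityMass_sub (i := c3) (e := e3) (a := 7) rfl
    (fun w => ⟨_, walk_c3 w⟩) (by norm_num) (by linarith) le_rfl h7t ht.2
  have hc4 := hd.walkMass_walkC4_le_commodityMass_sub ht
  have hsum := hd.induces.sum_commodityMass_sub_le e3 {c3, c4}
    (hd.mem_H (t := 7) (by norm_num) (by linarith [hd.twenty_le]))
    (hd.mem_H (t := t) (by linarith) (by linarith [ht.2])) h7t
  rw [Finset.sum_pair (by decide)] at hsum
  linarith

theorem nine_lt_arrival_c2 (hd : IsDirect h g D) (w : (𝒩).Walk c2) {w' : List FigEdge}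
    (hw : w.1 = e5 :: e4 :: e6 :: e5 :: e4 :: w') {s : ℝ} (hs : s ∈ Ioo 2 3) :
    9 < arrival D w.1 4 s := by
  obtain ⟨hs2, hs3⟩ := hs
  have hs5 : s ∈ Icc 0 5 := ⟨by linarith, by linarith⟩
  have hlen : 4 < w.1.length := by simp [hw]
  have harr := hd.arrival_two_c2 w (s := s) ⟨by linarith, hs3.le⟩
  have he6 : arrival D w.1 2 s + 4 ≤ arrival D w.1 3 s :=
    hd.arrival_add_τ_le w (e := e6) (by norm_num) (by norm_num) (by omega) (by simp [hw]) hs5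
  have he5 : arrival D w.1 3 s + (2 - ε) ≤ arrival D w.1 4 s :=
    hd.arrival_add_τ_le w (e := e5) (by norm_num) (by norm_num) (by omega) (by simp [hw]) hs5
  linarith [hd.ε_mem.2]

theorem nine_lt_arrival_c4 (hd : IsDirect h g D) (w : (𝒩).Walk c4) {w' : List FigEdge}
    (hw : w.1 = e1 :: e6 :: e5 :: e4 :: w') {s : ℝ} (hs : s ∈ Ioo 4 5) :
    9 < arrival D w.1 3 s := by
  obtain ⟨hs4, hs5⟩ := hs
  have hs05 : s ∈ Icc 0 5 := ⟨by linarith, hs5.le⟩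
  have hlen : 3 < w.1.length := by simp [hw]
  have he1 : s + 1 ≤ arrival D w.1 1 s :=
    hd.arrival_add_τ_le w (j := 0) (e := e1) (by norm_num) (by norm_num) (by omega)
      (by simp [hw]) hs05
  have he6 : arrival D w.1 1 s + 4 ≤ arrival D w.1 2 s :=
    hd.arrival_add_τ_le w (e := e6) (by norm_num) (by norm_num) (by omega) (by simp [hw]) hs05
  have he5 : arrival D w.1 2 s + (2 - ε) ≤ arrival D w.1 3 s :=
    hd.arrival_add_τ_le w (e := e5) (by norm_num) (by norm_num) (by omega) (by simp [hw]) hs05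
  linarith [hd.ε_mem.2]

theorem sub_walkMass_walkC2_le (hd : IsDirect h g D) {t : ℝ}
    (ht : t ∈ Icc (clearTime : ℝ) (13 + M)) :
    2 - (𝒩).walkMass h ⟨c2, walkC2⟩ ≤
      (𝒩).commodityMass h D c2 e4 t - (𝒩).commodityMass h D c2 e4 9 := by
  obtain ⟨htK, htM⟩ := ht
  have hK := thirty_le_clearTime
  have hM := hd.twenty_le
  change demand M c2 - _ ≤ _
  rw [← hd.setIntegral_H_inflow]
  refine hd.induces.sub_walkMass_le_commodityMass_sub (integrableOn_inflow c2 volume_H_ne_top)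
    walkC2 (hd.mem_H (by norm_num) (by linarith)) (hd.mem_H (by linarith) htM) (by linarith)
    fun w hne => ?_
  obtain hw | ⟨w', hw⟩ := walk_c2 w
  · exact absurd (Subtype.ext hw) hne
  have hlen : 4 < w.1.length := by simp [hw]
  refine ⟨4, hlen, by simp [hw], ?_⟩
  filter_upwards [hd.ae_mem_Ioo (a := 2) (b := 3) rfl w] with s hs hne
  exact ⟨hd.nine_lt_arrival_c2 w hw (hs hne), (hd.arrival_le w le_rfl hlen.le
    ⟨by linarith [(hs hne).1], by linarith [(hs hne).2]⟩).trans htK⟩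

theorem sub_walkMass_walkC4_le (hd : IsDirect h g D) {t : ℝ}
    (ht : t ∈ Icc (clearTime : ℝ) (13 + M)) :
    1 - (𝒩).walkMass h ⟨c4, walkC4⟩ ≤
      (𝒩).commodityMass h D c4 e4 t - (𝒩).commodityMass h D c4 e4 9 := by
  obtain ⟨htK, htM⟩ := ht
  have hK := thirty_le_clearTime
  have hM := hd.twenty_le
  change demand M c4 - _ ≤ _
  rw [← hd.setIntegral_H_inflow]
  refine hd.induces.sub_walkMass_le_commodityMass_sub (integrableOn_inflow c4 volume_H_ne_top)
    walkC4 (hd.mem_H (by norm_num) (by linarith)) (hd.mem_H (by linarith) htM) (by linarith)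
    fun w hne => ?_
  obtain hw | ⟨w', hw⟩ := walk_c4 w
  · exact absurd (Subtype.ext hw) hne
  have hlen : 3 < w.1.length := by simp [hw]
  refine ⟨3, hlen, by simp [hw], ?_⟩
  filter_upwards [hd.ae_mem_Ioo (a := 4) (b := 5) rfl w] with s hs hne
  exact ⟨hd.nine_lt_arrival_c4 w hw (hs hne), (hd.arrival_le w (by norm_num) hlen.le
    ⟨by linarith [(hs hne).1], (hs hne).2.le⟩).trans htK⟩

theorem le_setIntegral_e4_sub (hd : IsDirect h g D) {t : ℝ}
    (ht : t ∈ Icc (clearTime : ℝ) (13 + M)) :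
    3 - (𝒩).walkMass h ⟨c2, walkC2⟩ - (𝒩).walkMass h ⟨c4, walkC4⟩ + 2 * (t - 9) ≤
      (∫ s in Icc 0 t, g e4 s) - ∫ s in Icc 0 9, g e4 s := by
  have hK := thirty_le_clearTime
  have h9t : 9 ≤ t := by linarith [ht.1]
  have hc2 := hd.sub_walkMass_walkC2_le ht
  have hc4 := hd.sub_walkMass_walkC4_le ht
  have hc5 := hd.mul_sub_le_commodityMass_sub (i := c5) (e := e4) (a := 9) rfl walk_c5
    (by norm_num) le_rfl le_rfl h9t ht.2
  have hsum := hd.induces.sum_commodityMass_sub_le e4 {c2, c4, c5}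
    (hd.mem_H (t := 9) (by norm_num) (by linarith [hd.twenty_le]))
    (hd.mem_H (t := t) (by linarith) ht.2) h9t
  rw [Finset.sum_insert (by decide), Finset.sum_pair (by decide)] at hsum
  linarith

section Cost

variable {D₀ : FigEdge → ℝ → ℝ}

theorem sum_demand_le (hd : IsDirect h g D) (s : Finset FigComm)
    (hmem : ∀ i ∈ s, ∀ w : (𝒩).Walk i, e ∈ w.1) :
    ∑ i ∈ s, demand M i ≤ ∫ t in (𝒩).H, g e t := by
  simp only [← hd.setIntegral_H_inflow]
  exact hd.induces.sum_setIntegral_inflow_le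
    (by linarith [hd.le_tf', hd.tf'_le, hd.twenty_le] : 0 ≤ tf) s
    (fun i _ => integrableOn_inflow i volume_H_ne_top) hmem

theorem le_cost (hd : IsDirect h g D) (hD₀ : (𝒩).IsTraversalTime g D₀) (s : Finset FigComm)
    (hmem : ∀ i ∈ s, ∀ w : (𝒩).Walk i, e ∈ w.1) {δ : ℝ} (hδ : 0 ≤ δ)
    (ha : 0 ≤ a) (hab : a ≤ b) (hb : b ≤ 13 + M) (hdelay : ∀ t ∈ Ioc a b, (𝒩).τ e + δ ≤ D₀ e t)
    (hrate : c * (b - a) ≤ (∫ t in Icc 0 b, g e t) - ∫ t in Icc 0 a, g e t) :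
    (𝒩).τ e * ∑ i ∈ s, demand M i + δ * (c * (b - a)) ≤ ∫ t in (𝒩).H, D₀ e t * g e t :=
  (add_le_add (mul_le_mul_of_nonneg_left (hd.sum_demand_le s hmem) (τ_mem_Icc hd.ε_mem e).1)
    (mul_le_mul_of_nonneg_left hrate hδ)).trans
      (hD₀.le_setIntegral_time_mul hd.tf'_le (hd.induces.isRate_edge e) (hd.induces.support e)
        ha hab (hd.mem_H (ha.trans hab) hb).2 hdelay)

theorem τ_mul_sum_demand_le (hd : IsDirect h g D) (hD₀ : (𝒩).IsTraversalTime g D₀)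
    (s : Finset FigComm) (hmem : ∀ i ∈ s, ∀ w : (𝒩).Walk i, e ∈ w.1) :
    (𝒩).τ e * ∑ i ∈ s, demand M i ≤ ∫ t in (𝒩).H, D₀ e t * g e t := by
  have hle := hd.le_cost hD₀ s hmem le_rfl le_rfl le_rfl (a := 0) (c := 0)
    (by linarith [hd.twenty_le]) (by simp) (by simp)
  linarith

theorem mul_sub_le_setIntegral_sub (hd : IsDirect h g D)
    (hr : (𝒩).inflow i = (Icc a b).indicator fun _ => c)
    (hhead : ∀ w : (𝒩).Walk i, ∃ w', w.1 = e :: w') (ha : 0 ≤ a) (hb : b ≤ 13 + M)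
    {t₁ t₂ : ℝ} (hat : a ≤ t₁) (ht : t₁ ≤ t₂) (htb : t₂ ≤ b) :
    c * (t₂ - t₁) ≤ (∫ t in Icc 0 t₂, g e t) - ∫ t in Icc 0 t₁, g e t := by
  have hsum := hd.induces.sum_commodityMass_sub_le e {i}
    (hd.mem_H (by linarith) (by linarith)) (hd.mem_H (by linarith) (by linarith)) ht
  rw [Finset.sum_singleton] at hsum
  exact (hd.mul_sub_le_commodityMass_sub hr hhead ha hb hat ht htb).trans hsum

theorem le_cost_e3 (hd : IsDirect h g D) (hD₀ : (𝒩).IsTraversalTime g D₀) :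
    ε * (4 + M) + ((𝒩).walkMass h ⟨c2, walkC2⟩ + (𝒩).walkMass h ⟨c4, walkC4⟩ - 2) *
      (10 + M - clearTime) ≤ ∫ t in (𝒩).H, D₀ e3 t * g e3 t := by
  set l := (𝒩).walkMass h ⟨c2, walkC2⟩ + (𝒩).walkMass h ⟨c4, walkC4⟩ - 2
  have hK := thirty_le_clearTime
  have hKM := hd.clearTime_le
  have hdelay : ∀ t ∈ Ioc (clearTime : ℝ) (10 + M), (𝒩).τ e3 + max 0 l ≤ D₀ e3 t := by
    intro t ht
    have htH' := hd.mem_H' (t := t) (by linarith [ht.1]) (by linarith [ht.2])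
    rw [← max_add_add_left, add_zero]
    refine max_le (hD₀.τ_le hd.tf'_le e3 htH') (le_trans ?_ (hD₀.le_time hd.tf'_le
      (e := e3) (c := 1) (s := 7) (by simp [figNetwork]) one_pos hd.ε_mem.1.le (by norm_num)
      (by linarith [ht.1]) htH'.2))
    linarith [hd.le_setIntegral_e3_sub (Ioc_subset_Icc_self ht)]
  have hle := hd.le_cost hD₀ {c3, c4} (e := e3) ?_ (le_max_left 0 l) (by linarith) hKM
    (by linarith) hdelay (hd.mul_sub_le_setIntegral_sub (i := c3) (a := 7) rfl
      (fun w => ⟨_, walk_c3 w⟩) (by norm_num) (by linarith) (by linarith) hKM le_rfl)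
  · rw [Finset.sum_pair (by decide)] at hle
    refine le_trans (add_le_add (le_of_eq ?_) ?_) hle
    · simp only [demand, figNetwork]
      ring
    · rw [one_mul]
      exact mul_le_mul_of_nonneg_right (le_max_right 0 l) (sub_nonneg.2 hKM)
  · intro i hi w
    simp only [Finset.mem_insert, Finset.mem_singleton] at hi
    obtain rfl | rfl := hi <;> exact e3_mem_of_isWalk w.2 (by simp [figNetwork])

theorem le_cost_e4 (hd : IsDirect h g D) (hD₀ : (𝒩).IsTraversalTime g D₀) :
    ε * (10 + 2 * M) +
      (3 - (𝒩).walkMass h ⟨c2, walkC2⟩ - (𝒩).walkMass h ⟨c4, walkC4⟩) * (13 + M - clearTime) ≤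
      ∫ t in (𝒩).H, D₀ e4 t * g e4 t := by
  set l := 3 - (𝒩).walkMass h ⟨c2, walkC2⟩ - (𝒩).walkMass h ⟨c4, walkC4⟩
  have hl : 0 ≤ l := by
    have hc2 := hd.walkMass_le_demand walkC2
    have hc4 := hd.walkMass_le_demand walkC4
    simp only [demand] at hc2 hc4
    linarith
  have hK := thirty_le_clearTime
  have hKM : (clearTime : ℝ) ≤ 13 + M := by linarith [hd.clearTime_le]
  have hdelay : ∀ t ∈ Ioc (clearTime : ℝ) (13 + M), (𝒩).τ e4 + l / 2 ≤ D₀ e4 t := by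
    intro t ht
    have htH' := hd.mem_H' (t := t) (by linarith [ht.1]) ht.2
    refine le_trans ?_ (hD₀.le_time hd.tf'_le (e := e4) (c := 2) (s := 9)
      (by simp [figNetwork]) two_pos hd.ε_mem.1.le (by norm_num) (by linarith [ht.1]) htH'.2)
    linarith [hd.le_setIntegral_e4_sub (Ioc_subset_Icc_self ht)]
  have hle := hd.le_cost hD₀ {c2, c5} (e := e4) ?_ (div_nonneg hl two_pos.le) (by linarith) hKM
    le_rfl hdelay (hd.mul_sub_le_setIntegral_sub (i := c5) (a := 9) rfl walk_c5 (by norm_num) le_rfl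
      (by linarith) hKM le_rfl)
  · rw [Finset.sum_pair (by decide)] at hle
    refine le_of_eq_of_le ?_ hle
    simp only [demand, figNetwork]
    ring
  · intro i hi w
    simp only [Finset.mem_insert, Finset.mem_singleton] at hi
    obtain rfl | rfl := hi
    · obtain ⟨w', hw⟩ := walk_c2_prefix w
      simp [hw]
    · obtain ⟨w', hw⟩ := walk_c5 w
      simp [hw]

theorem le_pairing (hd : IsDirect h g D) (hD₀ : (𝒩).IsTraversalTime g D₀) :
    14 - 2 * ε + ε * (4 + M) + ε * (10 + 2 * M) + (10 + M - clearTime) ≤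
      (𝒩).pairing D₀ g := by
  have he1 := hd.τ_mul_sum_demand_le hD₀ (e := e1) {c4} fun i hi w => by
    obtain rfl := Finset.mem_singleton.1 hi
    obtain ⟨w', hw⟩ := walk_c4_prefix w
    simp [hw]
  have he2 := hd.τ_mul_sum_demand_le hD₀ (e := e2) {c2, c4} fun i hi w => by
    simp only [Finset.mem_insert, Finset.mem_singleton] at hi
    obtain rfl | rfl := hi <;>
      exact e2_mem_of_isWalk w.2 (by simp [figNetwork]) (by simp [figNetwork])
  have he5 := hd.τ_mul_sum_demand_le hD₀ (e := e5) {c2} fun i hi w => by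
    obtain rfl := Finset.mem_singleton.1 hi
    obtain ⟨w', hw⟩ := walk_c2_prefix w
    simp [hw]
  have he6 := hd.τ_mul_sum_demand_le hD₀ (e := e6) ∅ (by simp)
  have he7 := hd.τ_mul_sum_demand_le hD₀ (e := e7) {c1} fun i hi w => by
    obtain rfl := Finset.mem_singleton.1 hi
    obtain hw | ⟨w', hw⟩ := walk_c1 w <;> simp [hw]
  have he3 := hd.le_cost_e3 hD₀
  have he4 := hd.le_cost_e4 hD₀
  have hc2 := hd.walkMass_le_demand walkC2
  have hc4 := hd.walkMass_le_demand walkC4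
  rw [Finset.sum_pair (by decide)] at he2
  change 1 * _ ≤ _ at he1
  change 1 * _ ≤ _ at he2
  change (2 - ε) * _ ≤ _ at he5
  change 4 * _ ≤ _ at he6
  change 1 * _ ≤ _ at he7
  simp only [Finset.sum_singleton, Finset.sum_empty, demand] at he1 he2 he5 he6 he7 hc2 hc4
  rw [pairing, FigEdge.sum_univ]
  linarith

end Cost

end IsDirect

theorem ae_eq_zero_of_isEquilibrium (hε : ε ∈ Ioc 0 1) (htf : tf' ≤ tf) (hK : clearTime ≤ tf')
    (hI : (𝒩).Induces h g D) {p : FigEdge → ℝ → ℝ} (hp : ∀ e, ∀ t ∈ (𝒩).H, 0 ≤ p e t)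
    (heq : (𝒩).IsEquilibrium h D p) (w : (𝒩).Walk c1) (hw : w.1 ≠ [e7]) :
    ∀ᵐ s ∂(volume.restrict (𝒩).H), h ⟨c1, w⟩ s = 0 := by
  obtain hw' | ⟨w', hw'⟩ := walk_c1 w
  · exact absurd hw' hw
  filter_upwards [heq c1 w, ae_mem_Ioo_of_ne_zero hI (a := 0) (b := 1) rfl w,
    (hI.isRate_walk ⟨c1, w⟩).2, ae_restrict_mem measurableSet_H] with s hopt hsupp hnonneg hsH
  by_contra hne
  have hs := hsupp hne
  have hexit : s + D e7 s ≤ tf' :=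
    (exit_le_exitBound hε htf hI e7 (n := 5) (((iterate_exitBound_le_clearTime
      (j := 0) (by norm_num)).trans hK)) ⟨hs.1.le, by norm_num; linarith [hs.2]⟩).trans
        ((iterate_exitBound_le_clearTime (j := 1) (by norm_num)).trans hK)
  have hexit0 : 0 ≤ s + D e7 s := add_nonneg hsH.1 (hI.traversal.nonneg e7 s hsH)
  have hloop : 2 - ε ≤ D e5 (s + D e7 s) := hI.traversal.τ_le htf e5 ⟨hexit0, hexit⟩
  have htoll := hp e5 (s + D e7 s) ⟨hexit0, hexit.trans htf⟩
  have htime := hI.traversal.add_le_walkCost hI.traversal.nonneg w hw' hsH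
  have htolls := hI.traversal.add_le_walkCost hp w hw' hsH
  have hle := hopt (hnonneg.lt_of_ne' hne) ⟨[e7], rfl, rfl⟩
  have hsingle : ∀ c : FigEdge → ℝ → ℝ, walkCost D c [e7] s = c e7 s := fun c =>
    Fin.sum_univ_one _
  change 1 * _ + _ ≤ 1 * walkCost D D [e7] s + walkCost D p [e7] s at hle
  rw [hsingle, hsingle] at hle
  linarith [hε.2]

end Direct

section Detour

variable {e : FigEdge} {i : FigComm} {s t : ℝ}

/-- The walk of each commodity in the walk flow that proves the system optimum to be cheap: the
first commodity makes a detour through the cycle `e5, e4, e6`, all others go straight. -/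
def detourWalk : ∀ i, (𝒩).Walk i
  | .c1 => ⟨[e7, e5, e4, e6], rfl, rfl, rfl, rfl, rfl⟩
  | .c2 => walkC2
  | .c3 => ⟨[e3], rfl, rfl⟩
  | .c4 => walkC4
  | .c5 => ⟨[e4], rfl, rfl⟩

open Classical in
/-- The walk flow that sends every commodity along its `detourWalk`. -/
noncomputable def detourWalkFlow (w : (𝒩).CWalk) (t : ℝ) : ℝ :=
  if w.2 = detourWalk w.1 then (𝒩).inflow w.1 t else 0

/-- The edge flow induced by `detourWalkFlow`. -/
noncomputable def detourFlow (M ε : ℝ) : FigEdge → ℝ → ℝ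
  | .e1 => (Icc 4 5).indicator fun _ => 1
  | .e2 => fun t => (Icc 5 6).indicator (fun _ => 1) t + (Icc 6 7).indicator (fun _ => 2) t
  | .e3 => (Icc 6 (10 + M)).indicator fun _ => 1
  | .e4 => fun t => (Icc (3 - ε) (7 - ε)).indicator (fun _ => 2) t +
      (Icc 9 (13 + M)).indicator (fun _ => 2) t
  | .e5 => fun t => (Icc 1 2).indicator (fun _ => 6) t + (Icc 2 3).indicator (fun _ => 2) t
  | .e6 => (Icc 3 6).indicator fun _ => 2
  | .e7 => (Icc 0 1).indicator fun _ => 6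

/-- The waiting times in the queues under `detourFlow`. -/
noncomputable def detourWait : FigEdge → ℝ → ℝ
  | .e2 => fun t => max 0 (min (t - 6) (8 - t))
  | .e5 => fun t => max 0 (min (2 * (t - 1)) (min 2 (5 - t)))
  | _ => fun _ => 0

/-- The traversal times under `detourFlow`, cut off at the end of the horizon. -/
noncomputable def detourTime (M ε tf' tf : ℝ) (e : FigEdge) (t : ℝ) : ℝ :=
  min ((figNetwork M ε tf' tf).τ e + detourWait e t) (tf - t)

local notation "𝒟" => detourTime M ε tf' tf

theorem integrable_detourFlow (e : FigEdge) : Integrable (detourFlow M ε e) := by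
  cases e <;> first
    | exact integrable_indicator_Icc _ _ _
    | exact (integrable_indicator_Icc _ _ _).add (integrable_indicator_Icc _ _ _)

theorem detourFlow_nonneg (e : FigEdge) (t : ℝ) : 0 ≤ detourFlow M ε e t := by
  cases e <;> simp only [detourFlow, indicator] <;> split_ifs <;> norm_num

theorem detourFlow_eq_zero (hM : 0 ≤ M) (hε : ε ∈ Ioc 0 1) (e : FigEdge)
    (ht : t ∉ Icc 0 (13 + M)) : detourFlow M ε e t = 0 := by
  obtain ⟨hε0, hε1⟩ := hε
  have hzero : ∀ a b c : ℝ, 0 ≤ a → b ≤ 13 + M → (Icc a b).indicator (fun _ => c) t = 0 :=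
    fun a b c ha hb => indicator_of_notMem (fun h => ht (Icc_subset_Icc ha hb h)) _
  cases e <;> simp only [detourFlow] <;> first
    | exact hzero _ _ _ (by linarith) (by linarith)
    | rw [hzero _ _ _ (by linarith) (by linarith), hzero _ _ _ (by linarith) (by linarith),
        add_zero]

theorem setIntegral_detourFlow (hε : ε ≤ 1) (e : FigEdge) (t : ℝ) :
    ∫ s in Icc 0 t, detourFlow M ε e s = match e with
      | .e1 => max 0 (min t 5 - 4)
      | .e2 => max 0 (min t 6 - 5) + 2 * max 0 (min t 7 - 6)
      | .e3 => max 0 (min t (10 + M) - 6)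
      | .e4 => 2 * max 0 (min t (7 - ε) - (3 - ε)) + 2 * max 0 (min t (13 + M) - 9)
      | .e5 => 6 * max 0 (min t 2 - 1) + 2 * max 0 (min t 3 - 2)
      | .e6 => 2 * max 0 (min t 6 - 3)
      | .e7 => 6 * max 0 (min t 1 - 0) := by
  cases e <;> simp only [detourFlow] <;> first
    | rw [setIntegral_Icc_indicator _ _ (by linarith)]
    | rw [integral_add (integrable_indicator_Icc _ _ _).integrableOn
        (integrable_indicator_Icc _ _ _).integrableOn, setIntegral_Icc_indicator _ _ (by linarith),
        setIntegral_Icc_indicator _ _ (by linarith)]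
  all_goals simp only [one_mul]

theorem detourWait_nonneg (e : FigEdge) (t : ℝ) : 0 ≤ detourWait e t := by
  cases e <;> first | exact le_rfl | exact le_max_left _ _

theorem detourWait_le_two (e : FigEdge) (t : ℝ) : detourWait e t ≤ 2 := by
  cases e <;> simp only [detourWait] <;> grind

theorem monotone_add_detourWait (e : FigEdge) : Monotone fun t => t + detourWait e t := by
  intro s t hst
  cases e <;> simp only [detourWait] <;> grind

theorem exists_lipschitzWith_detourWait (e : FigEdge) : ∃ K, LipschitzWith K (detourWait e) := by
  cases e with
  | e2 =>
    have hfun : detourWait e2 = fun t => max (min (1 * t + -6) (-1 * t + 8)) 0 := by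
      funext t
      simp only [detourWait]
      grind
    rw [hfun]
    exact ⟨_, ((lipschitzWith_mul_add 1 (-6)).min (lipschitzWith_mul_add (-1) 8)).max_const 0⟩
  | e5 =>
    have hfun : detourWait e5 = fun t => max (min (2 * t + -2) (min 2 (-1 * t + 5))) 0 := by
      funext t
      simp only [detourWait]
      grind
    rw [hfun]
    exact ⟨_, ((lipschitzWith_mul_add 2 (-2)).min ((LipschitzWith.const 2).min
      (lipschitzWith_mul_add (-1) 5))).max_const 0⟩
  | _ => exact ⟨0, LipschitzWith.const 0⟩

theorem isVickreyTime_detourFlow_e2 (hM : 0 ≤ M) (hε : ε ∈ Ioc 0 1) (htf : 13 + M ≤ tf) :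
    (𝒩).IsVickreyTime e2 (detourFlow M ε e2) fun t => (𝒩).τ e2 + detourWait e2 t := by
  let exitInv : ℝ → ℝ := fun t => if t < 7 then t - 1 else if t < 9 then (t + 5) / 2 else t - 1
  refine isVickreyTime_of_outflow_indicator (σ := exitInv) (a := 6) (b := 9) (c := 1)
    (τ_mem_Icc hε e2).1 (by simp [figNetwork]) one_pos (by norm_num) (detourWait_nonneg e2)
    (fun s hs => detourFlow_eq_zero hM hε e2 fun h => (htf.trans_lt hs).not_ge h.2)
    (fun t s => ?_) (fun t => ?_) fun t => ?_
  · simp only [figNetwork, detourWait, exitInv]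
    grind
  · rw [setIntegral_detourFlow hε.2]
    simp only [exitInv]
    grind
  · rw [setIntegral_detourFlow hε.2]
    simp only [figNetwork, detourWait]
    grind

theorem isVickreyTime_detourFlow_e5 (hM : 0 ≤ M) (hε : ε ∈ Ioc 0 1) (htf : 13 + M ≤ tf) :
    (𝒩).IsVickreyTime e5 (detourFlow M ε e5) fun t => (𝒩).τ e5 + detourWait e5 t := by
  let exitInv : ℝ → ℝ := fun t =>
    if t < 3 - ε then t - 2 + ε else if t < 6 - ε then (t + ε) / 3 else
      if t < 7 - ε then t - 4 + ε else t - 2 + ε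
  refine isVickreyTime_of_outflow_indicator (σ := exitInv) (a := 3 - ε) (b := 7 - ε) (c := 2)
    (τ_mem_Icc hε e5).1 (by simp [figNetwork]) two_pos (by linarith [hε.2]) (detourWait_nonneg e5)
    (fun s hs => detourFlow_eq_zero hM hε e5 fun h => (htf.trans_lt hs).not_ge h.2)
    (fun t s => ?_) (fun t => ?_) fun t => ?_
  all_goals obtain ⟨_, hε1⟩ := hε
  · simp only [figNetwork, detourWait, exitInv]
    grind
  · rw [setIntegral_detourFlow hε1]
    simp only [exitInv]
    grind
  · rw [setIntegral_detourFlow hε1]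
    simp only [figNetwork, detourWait]
    grind

theorem ofReal_detourFlow_le_ν (h2 : e ≠ e2) (h5 : e ≠ e5) (hε : 0 < ε) (t : ℝ) :
    ENNReal.ofReal (detourFlow M ε e t) ≤ (𝒩).ν e := by
  have hle : ∀ c : ℝ, (𝒩).ν e = ENNReal.ofReal c → detourFlow M ε e t ≤ c →
      ENNReal.ofReal (detourFlow M ε e t) ≤ (𝒩).ν e :=
    fun c hν hc => hν ▸ ENNReal.ofReal_le_ofReal hc
  cases e with
  | e2 => exact absurd rfl h2
  | e5 => exact absurd rfl h5
  | e6 => exact le_top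
  | e1 | e3 => exact hle 1 (by simp [figNetwork]) (by simp only [detourFlow, indicator]; grind)
  | e4 => exact hle 2 (by simp [figNetwork]) (by simp only [detourFlow, indicator]; grind)
  | e7 => exact hle 6 (by simp [figNetwork]) (by simp only [detourFlow, indicator]; grind)

theorem isVickreyTime_detourFlow (hM : 0 ≤ M) (hε : ε ∈ Ioc 0 1) (htf : 13 + M ≤ tf)
    (e : FigEdge) :
    (𝒩).IsVickreyTime e (detourFlow M ε e) fun t => (𝒩).τ e + detourWait e t := by
  obtain rfl | h2 := eq_or_ne e e2
  · exact isVickreyTime_detourFlow_e2 hM hε htf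
  obtain rfl | h5 := eq_or_ne e e5
  · exact isVickreyTime_detourFlow_e5 hM hε htf
  have hwait : ∀ t, detourWait e t = 0 := fun t => by cases e <;> first | rfl | contradiction
  simp only [hwait, add_zero]
  exact isVickreyTime_const (τ_mem_Icc hε e).1 (integrable_detourFlow e) (detourFlow_nonneg e)
    (fun t ht => detourFlow_eq_zero hM hε e fun h => ht.not_ge h.1)
    (fun t ht => detourFlow_eq_zero hM hε e fun h => (htf.trans_lt ht).not_ge h.2)
    (ofReal_detourFlow_le_ν h2 h5 hε.1)

theorem τ_add_detourWait_nonneg (hε : ε ∈ Ioc 0 1) (e : FigEdge) (t : ℝ) :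
    0 ≤ (𝒩).τ e + detourWait e t :=
  add_nonneg (τ_mem_Icc hε e).1 (detourWait_nonneg e t)

theorem detourTime_eq (hε : ε ∈ Ioc 0 1) (htf : tf' + 6 ≤ tf) (e : FigEdge) (ht : t ≤ tf') :
    𝒟 e t = (𝒩).τ e + detourWait e t :=
  min_eq_left (by
    linarith [detourWait_le_two e t, (τ_mem_Icc (M := M) (tf' := tf') (tf := tf) hε e).2])

theorem add_detourTime (e : FigEdge) (t : ℝ) :
    t + 𝒟 e t = min (t + ((𝒩).τ e + detourWait e t)) tf := by
  rw [detourTime, ← min_add_add_left, add_sub_cancel]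

theorem monotone_add_detourTime (e : FigEdge) : Monotone fun t => t + 𝒟 e t := by
  intro s t hst
  simp only [add_detourTime, add_left_comm _ ((𝒩).τ e)]
  exact min_le_min_right _ (add_le_add_right (monotone_add_detourWait e hst) _)

theorem exists_lipschitzWith_detourTime (e : FigEdge) : ∃ K, LipschitzWith K (𝒟 e) := by
  obtain ⟨K, hK⟩ := exists_lipschitzWith_detourWait e
  have hcut : LipschitzWith 1 fun t : ℝ => tf - t := by
    simpa [sub_eq_add_neg, add_comm] using lipschitzWith_mul_add (-1) tf
  exact ⟨_, ((LipschitzWith.const _).add hK).min hcut⟩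

theorem isTraversalTime_detourTime (hM : 0 ≤ M) (hε : ε ∈ Ioc 0 1) (h13 : 13 + M ≤ tf')
    (htf : tf' + 6 ≤ tf) : (𝒩).IsTraversalTime (detourFlow M ε) 𝒟 where
  vickrey e := ⟨_, isVickreyTime_detourFlow hM hε (by linarith) e,
    fun t ht => detourTime_eq hε htf e ht.2⟩
  nonneg e t ht := le_min (τ_add_detourWait_nonneg hε e t) (sub_nonneg.2 ht.2)
  absCont e := by
    obtain ⟨K, hK⟩ := exists_lipschitzWith_detourTime (M := M) (ε := ε) (tf' := tf') (tf := tf) e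
    exact (hK.lipschitzOnWith (s := uIcc 0 tf)).absolutelyContinuousOnInterval
  fifo e := (monotone_add_detourTime e).monotoneOn _
  mapsTo i w j _ := mapsTo_arrival (fun e t ht => by
    simp only [add_detourTime]
    exact ⟨le_min (add_nonneg ht.1 (τ_add_detourWait_nonneg hε e t)) (ht.1.trans ht.2),
      min_le_right _ _⟩) w.1 j

theorem arrival_detourTime_succ (hε : ε ∈ Ioc 0 1) (htf : tf' + 6 ≤ tf) {w : List FigEdge} {j : ℕ}
    (hj : j < w.length) (hs : arrival 𝒟 w j s = t) (ht : t ≤ tf') :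
    arrival 𝒟 w (j + 1) s = t + ((𝒩).τ w[j] + detourWait w[j] t) := by
  rw [arrival_succ _ _ hj, hs, detourTime_eq hε htf _ ht]

theorem edgeMass_detourWalk_c1 (hε : ε ∈ Ioc 0 1) (h7 : 7 ≤ tf') (htf : tf' + 6 ≤ tf)
    (e : FigEdge) (t : ℝ) :
    (𝒩).edgeMass 𝒟 ((𝒩).inflow c1) (detourWalk c1 : (𝒩).Walk c1).1 e t = match e with
      | .e4 => 2 * max 0 (min t (6 - ε) - (3 - ε))
      | .e5 => 6 * max 0 (min t 2 - 1)
      | .e6 => 2 * max 0 (min t 6 - 3)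
      | .e7 => 6 * max 0 (min t 1 - 0)
      | _ => 0 := by
  have harr1 : ∀ s ∈ Icc (0 : ℝ) 1, arrival 𝒟 [e7, e5, e4, e6] 1 s = 1 * s + 1 := fun s hs => by
    rw [arrival_detourTime_succ (t := s) hε htf (by simp) rfl (by linarith [hs.2])]
    simp [figNetwork, detourWait]
  have harr2 : ∀ s ∈ Icc (0 : ℝ) 1, arrival 𝒟 [e7, e5, e4, e6] 2 s = 3 * s + (3 - ε) :=
    fun s hs => by
      rw [arrival_detourTime_succ hε htf (by simp) (harr1 s hs) (by linarith [hs.2])]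
      simp only [figNetwork, detourWait, List.getElem_cons_succ, List.getElem_cons_zero]
      grind
  have harr3 : ∀ s ∈ Icc (0 : ℝ) 1, arrival 𝒟 [e7, e5, e4, e6] 3 s = 3 * s + 3 := fun s hs => by
    rw [arrival_detourTime_succ hε htf (by simp) (harr2 s hs) (by linarith [hs.2, hε.1])]
    simp only [figNetwork, detourWait, List.getElem_cons_succ, List.getElem_cons_zero]
    ring
  have htf1 : (1 : ℝ) ≤ (𝒩).tf := show 1 ≤ tf by linarith
  change (𝒩).edgeMass 𝒟 ((Icc 0 1).indicator fun _ => 6) [e7, e5, e4, e6] e t = _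
  rw [edgeMass_four, arrivedMass_indicator_zero le_rfl htf1,
    arrivedMass_indicator_of_affine le_rfl htf1 (by norm_num) (by norm_num) harr1,
    arrivedMass_indicator_of_affine le_rfl htf1 (by norm_num) (by linarith [hε.2]) harr2,
    arrivedMass_indicator_of_affine le_rfl htf1 (by norm_num) (by norm_num) harr3]
  cases e <;> simp <;> grind

theorem edgeMass_detourWalk_c2 (hε : ε ∈ Ioc 0 1) (h7 : 7 ≤ tf') (htf : tf' + 6 ≤ tf)
    (e : FigEdge) (t : ℝ) :
    (𝒩).edgeMass 𝒟 ((𝒩).inflow c2) (detourWalk c2 : (𝒩).Walk c2).1 e t = match e with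
      | .e2 => 2 * max 0 (min t 7 - 6)
      | .e4 => 2 * max 0 (min t (7 - ε) - (6 - ε))
      | .e5 => 2 * max 0 (min t 3 - 2)
      | _ => 0 := by
  have harr1 : ∀ s ∈ Icc (2 : ℝ) 3, arrival 𝒟 [e5, e4, e2] 1 s = 1 * s + (4 - ε) := fun s hs => by
    rw [arrival_detourTime_succ (t := s) hε htf (by simp) rfl (by linarith [hs.2])]
    simp only [figNetwork, detourWait, List.getElem_cons_zero]
    grind
  have harr2 : ∀ s ∈ Icc (2 : ℝ) 3, arrival 𝒟 [e5, e4, e2] 2 s = 1 * s + 4 := fun s hs => by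
    rw [arrival_detourTime_succ hε htf (by simp) (harr1 s hs) (by linarith [hs.2, hε.1])]
    simp only [figNetwork, detourWait, List.getElem_cons_succ, List.getElem_cons_zero]
    ring
  have htf3 : (3 : ℝ) ≤ (𝒩).tf := show 3 ≤ tf by linarith
  change (𝒩).edgeMass 𝒟 ((Icc 2 3).indicator fun _ => 2) [e5, e4, e2] e t = _
  rw [edgeMass_three, arrivedMass_indicator_zero (by norm_num) htf3,
    arrivedMass_indicator_of_affine (by norm_num) htf3 (by norm_num) (by linarith [hε.2]) harr1,
    arrivedMass_indicator_of_affine (by norm_num) htf3 (by norm_num) (by norm_num) harr2]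
  cases e <;> simp <;> grind

theorem edgeMass_detourWalk_c3 (htf : 10 + M ≤ tf) (e : FigEdge) (t : ℝ) :
    (𝒩).edgeMass 𝒟 ((𝒩).inflow c3) (detourWalk c3 : (𝒩).Walk c3).1 e t = match e with
      | .e3 => max 0 (min t (10 + M) - 7)
      | _ => 0 := by
  change (𝒩).edgeMass 𝒟 ((Icc 7 (10 + M)).indicator fun _ => 1) [e3] e t = _
  rw [edgeMass_singleton, arrivedMass_indicator_zero (by norm_num) htf]
  cases e <;> simp

theorem edgeMass_detourWalk_c4 (hε : ε ∈ Ioc 0 1) (h7 : 7 ≤ tf') (htf : tf' + 6 ≤ tf)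
    (e : FigEdge) (t : ℝ) :
    (𝒩).edgeMass 𝒟 ((𝒩).inflow c4) (detourWalk c4 : (𝒩).Walk c4).1 e t = match e with
      | .e1 => max 0 (min t 5 - 4)
      | .e2 => max 0 (min t 6 - 5)
      | .e3 => max 0 (min t 7 - 6)
      | _ => 0 := by
  have harr1 : ∀ s ∈ Icc (4 : ℝ) 5, arrival 𝒟 [e1, e2, e3] 1 s = 1 * s + 1 := fun s hs => by
    rw [arrival_detourTime_succ (t := s) hε htf (by simp) rfl (by linarith [hs.2])]
    simp [figNetwork, detourWait]
  have harr2 : ∀ s ∈ Icc (4 : ℝ) 5, arrival 𝒟 [e1, e2, e3] 2 s = 1 * s + 2 := fun s hs => by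
    rw [arrival_detourTime_succ hε htf (by simp) (harr1 s hs) (by linarith [hs.2])]
    simp only [figNetwork, detourWait, List.getElem_cons_succ, List.getElem_cons_zero]
    grind
  have htf5 : (5 : ℝ) ≤ (𝒩).tf := show 5 ≤ tf by linarith
  change (𝒩).edgeMass 𝒟 ((Icc 4 5).indicator fun _ => 1) [e1, e2, e3] e t = _
  rw [edgeMass_three, arrivedMass_indicator_zero (by norm_num) htf5,
    arrivedMass_indicator_of_affine (by norm_num) htf5 (by norm_num) (by norm_num) harr1,
    arrivedMass_indicator_of_affine (by norm_num) htf5 (by norm_num) (by norm_num) harr2]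
  cases e <;> simp <;> grind

theorem edgeMass_detourWalk_c5 (htf : 13 + M ≤ tf) (e : FigEdge) (t : ℝ) :
    (𝒩).edgeMass 𝒟 ((𝒩).inflow c5) (detourWalk c5 : (𝒩).Walk c5).1 e t = match e with
      | .e4 => 2 * max 0 (min t (13 + M) - 9)
      | _ => 0 := by
  change (𝒩).edgeMass 𝒟 ((Icc 9 (13 + M)).indicator fun _ => 2) [e4] e t = _
  rw [edgeMass_singleton, arrivedMass_indicator_zero (by norm_num) htf]
  cases e <;> simp

theorem sum_edgeMass_detourWalk (hM : 0 ≤ M) (hε : ε ∈ Ioc 0 1) (h13 : 13 + M ≤ tf')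
    (htf : tf' + 6 ≤ tf) (e : FigEdge) (t : ℝ) :
    ∑ i, (𝒩).edgeMass 𝒟 ((𝒩).inflow i) (detourWalk i : (𝒩).Walk i).1 e t =
      ∫ s in Icc 0 t, detourFlow M ε e s := by
  have h7 : 7 ≤ tf' := by linarith
  rw [FigComm.sum_univ, setIntegral_detourFlow hε.2, edgeMass_detourWalk_c1 hε h7 htf,
    edgeMass_detourWalk_c2 hε h7 htf, edgeMass_detourWalk_c3 (by linarith),
    edgeMass_detourWalk_c4 hε h7 htf, edgeMass_detourWalk_c5 (by linarith)]
  have := hε.2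
  cases e <;> grind

theorem detourWalkFlow_self (i : FigComm) :
    detourWalkFlow (⟨i, detourWalk i⟩ : (𝒩).CWalk) = (𝒩).inflow i :=
  funext fun _ => if_pos rfl

theorem detourWalkFlow_of_ne {w : (𝒩).CWalk} (hw : w.2 ≠ detourWalk w.1) :
    detourWalkFlow w = fun _ => 0 :=
  funext fun _ => if_neg hw

theorem isRate_detourWalkFlow (w : (𝒩).CWalk) : (𝒩).IsRate (detourWalkFlow w) := by
  obtain ⟨i, w⟩ := w
  by_cases hw : w = detourWalk i
  · rw [hw, detourWalkFlow_self]
    refine ⟨integrableOn_inflow i volume_H_ne_top, Filter.Eventually.of_forall fun t => ?_⟩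
    cases i <;> simp only [figNetwork, indicator] <;> split_ifs <;> norm_num
  · rw [detourWalkFlow_of_ne (w := ⟨i, w⟩) hw]
    exact ⟨integrableOn_zero, Filter.Eventually.of_forall fun _ => le_rfl⟩

theorem hasSum_detourWalkFlow (i : FigComm) (t : ℝ) :
    HasSum (fun w : (𝒩).Walk i => detourWalkFlow ⟨i, w⟩ t) ((𝒩).inflow i t) := by
  rw [← detourWalkFlow_self]
  exact hasSum_single _ fun w hw => by rw [detourWalkFlow_of_ne (w := ⟨i, w⟩) hw]

theorem hasSum_edgeMass_detourWalkFlow (D : FigEdge → ℝ → ℝ) (e : FigEdge) (t : ℝ) :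
    HasSum (fun w : (𝒩).CWalk => (𝒩).edgeMass D (detourWalkFlow w) w.2.1 e t)
      (∑ i, (𝒩).edgeMass D ((𝒩).inflow i) (detourWalk i : (𝒩).Walk i).1 e t) := by
  have hinj : Function.Injective fun i => (⟨i, detourWalk i⟩ : (𝒩).CWalk) :=
    fun i j hij => congrArg Sigma.fst hij
  refine (hinj.hasSum_iff ?_).1 ?_
  · rintro ⟨i, w⟩ hw
    have hne : w ≠ detourWalk i := fun h => hw ⟨i, by rw [h]⟩
    rw [detourWalkFlow_of_ne (w := ⟨i, w⟩) hne]
    exact edgeMass_eq_zero fun k _ _ => by simp [arrivedMass]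
  · have hself : ∀ i, (𝒩).edgeMass D (detourWalkFlow ⟨i, detourWalk i⟩) (detourWalk i).1 e t =
        (𝒩).edgeMass D ((𝒩).inflow i) (detourWalk i : (𝒩).Walk i).1 e t :=
      fun i => by rw [detourWalkFlow_self]
    simp only [← hself]
    exact hasSum_fintype _

theorem induces_detourFlow (hM : 0 ≤ M) (hε : ε ∈ Ioc 0 1) (h13 : 13 + M ≤ tf')
    (htf : tf' + 6 ≤ tf) : (𝒩).Induces detourWalkFlow (detourFlow M ε) 𝒟 where
  isRate_walk := isRate_detourWalkFlow
  sum_walk i := Filter.Eventually.of_forall (hasSum_detourWalkFlow i)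
  isRate_edge e := ⟨(integrable_detourFlow e).integrableOn,
    Filter.Eventually.of_forall (detourFlow_nonneg e)⟩
  support e := Filter.Eventually.of_forall fun t ht => detourFlow_eq_zero hM hε e fun htM =>
    ht ⟨htM.1, htM.2.trans h13⟩
  traversal := isTraversalTime_detourTime hM hε h13 htf
  loading e t _ := by
    rw [← sum_edgeMass_detourWalk hM hε h13 htf e t]
    exact hasSum_edgeMass_detourWalkFlow _ e t

theorem setIntegral_detourTime_mul_le {B : ℝ} (hB : ∀ t, (𝒩).τ e + detourWait e t ≤ B) :
    ∫ t in (𝒩).H, 𝒟 e t * detourFlow M ε e t ≤ B * ∫ t in Icc 0 tf, detourFlow M ε e t := by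
  obtain ⟨K, hK⟩ := exists_lipschitzWith_detourTime (M := M) (ε := ε) (tf' := tf') (tf := tf) e
  rw [← integral_const_mul]
  refine setIntegral_mono ?_ ((integrable_detourFlow e).integrableOn.const_mul _) fun t => ?_
  · exact (integrable_detourFlow e).integrableOn.continuousOn_mul hK.continuous.continuousOn
      isCompact_Icc
  · exact mul_le_mul_of_nonneg_right ((min_le_left _ _).trans (hB t)) (detourFlow_nonneg e t)

theorem pairing_detourFlow_le (hM : 0 ≤ M) (hε : ε ∈ Ioc 0 1) (htf : 13 + M ≤ tf) :
    (𝒩).pairing 𝒟 (detourFlow M ε) ≤ 69 - 8 * ε + ε * (4 + M) + ε * (16 + 2 * M) := by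
  have hcost : ∀ e B, (∀ t, (𝒩).τ e + detourWait e t ≤ B) →
      ∫ t in (𝒩).H, 𝒟 e t * detourFlow M ε e t ≤ B * ∫ t in Icc 0 tf, detourFlow M ε e t :=
    fun e B hB => setIntegral_detourTime_mul_le hB
  have hcost1 := hcost e1 1 fun _ => (add_zero (1 : ℝ)).le
  have hcost2 := hcost e2 2 fun t => by
    simp only [figNetwork, detourWait]
    grind
  have hcost3 := hcost e3 ε fun _ => (add_zero ε).le
  have hcost4 := hcost e4 ε fun _ => (add_zero ε).le
  have hcost5 := hcost e5 (4 - ε) fun t => by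
    simp only [figNetwork]
    linarith [detourWait_le_two e5 t]
  have hcost6 := hcost e6 4 fun _ => (add_zero (4 : ℝ)).le
  have hcost7 := hcost e7 1 fun _ => (add_zero (1 : ℝ)).le
  have hmass : ∀ a b : ℝ, a ≤ b → b ≤ 13 + M → max 0 (min tf b - a) = b - a := fun a b hab hb => by
    rw [min_eq_right (hb.trans htf), max_eq_right (sub_nonneg.2 hab)]
  obtain ⟨hε0, hε1⟩ := hε
  simp only [setIntegral_detourFlow hε1] at hcost1 hcost2 hcost3 hcost4 hcost5 hcost6 hcost7
  rw [hmass _ _ (by linarith) (by linarith)] at hcost1 hcost3 hcost6 hcost7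
  rw [hmass _ _ (by linarith) (by linarith), hmass _ _ (by linarith) (by linarith)]
    at hcost2 hcost4 hcost5
  rw [VickreyNetwork.pairing, FigEdge.sum_univ]
  linarith

end Detour

end FigNet

theorem mainTheorem1 :
    ∃ M₀ : ℝ, 0 ≤ M₀ ∧ ∀ M : ℝ, M₀ ≤ M → ∀ ε : ℝ, 0 < ε → ε ≤ 1 →
      ∀ tf' tf : ℝ, 13 + M ≤ tf' → tf' + (24 + 3 * M) ≤ tf →
        ∀ g : FigEdge → ℝ → ℝ,
          (figNetwork M ε tf' tf).IsSystemOptimal g →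
            ¬ (figNetwork M ε tf' tf).IsImplementable g := by
  refine ⟨FigNet.clearTime + 46, by positivity, ?_⟩
  rintro M hM ε hε hε1 tf' tf h13 htf g ⟨h₀, D₀, hI₀, hopt⟩ ⟨h, D, p, hI, hp, -, heq⟩
  have : (0 : ℝ) ≤ FigNet.clearTime := Nat.cast_nonneg _
  have hdirect : FigNet.IsDirect h g D :=
    { ε_mem := ⟨hε, hε1⟩
      le_tf' := h13
      tf'_le := by linarith
      clearTime_le := by linarith
      induces := hI
      direct := FigNet.ae_eq_zero_of_isEquilibrium ⟨hε, hε1⟩ (by linarith) (by linarith) hI hp heq }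
  have hlower := hdirect.le_pairing hI₀.traversal
  have hle := hopt _ _ _
    (FigNet.induces_detourFlow (by linarith) ⟨hε, hε1⟩ h13 (by linarith))
  have hupper := FigNet.pairing_detourFlow_le (M := M) (ε := ε) (tf' := tf') (tf := tf)
    (by linarith) ⟨hε, hε1⟩ (by linarith)
  linarith
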